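/- Let $X$ be a complex Banach space and let $2\le p<\infty$. Let $\mathbb T^{\mathbb N}$ carry its normalized Haar measure, let $p_1<p_2<\cdots$ be the primes, and for a finitely supported sequence $\alpha$ of non-negative integers put $n(\alpha)=p_1^{\alpha_1}p_2^{\alpha_2}\cdots$. A formal Dirichlet series $D=\sum_n x_n n^{-s}$ with coefficients in $X$ belongs to $\mathcal H_p(X)$ if there is $f\in L_p(\mathbb T^{\mathbb N},X)$ whose Fourier coefficients satisfy $\hat f(\alpha)=x_{n(\alpha)}$ for every finitely supported sequence $\alpha$ of non-negative integers and $\hat f(\alpha)=0$ for every finitely supported sequence $\alpha$ of integers with a negative entry; this $f$ is unique, and $\|D\|_{\mathcal H_p(X)}=\|f\|_{L_p}$. Let $(\varepsilon_n)$ be independent uniformly distributed signs. The space $\mathcal H_p^{rad}(X)$ consists of the formal series $\sum_n x_n n^{-s}$ such that $\sum_n\varepsilon_n x_n n^{-s}\in\mathcal H_p(X)$ for almost every choice of signs, and $\|\sum_n x_n n^{-s}\|_{\mathcal H_p^{rad}(X)}=\mathbb E\|\sum_n\varepsilon_n x_n n^{-s}\|_{\mathcal H_p(X)}$. A sequence $(y_n)$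 in a Banach space is called RUC if there is a constant $C$ with $\mathbb E\|\sum_{n=1}^m\varepsilon_n a_n y_n\|\le C\|\sum_{n=1}^m a_n y_n\|$ for all $m\in\mathbb N$ and all $a_1,\dots,a_m\in\mathbb C$. The following statements are equivalent: (a) $(x_n n^{-s})_n$ is RUC in $\mathcal H_p(X)$ for every sequence $(x_n)_n\subset X$. (b) There is $C\ge 1$ such that for every $N\in\mathbb N$ and all $x_1,\dots,x_N\in X$, $$\Big\|\sum_{n=1}^N x_n n^{-s}\Big\|_{\mathcal H_p^{rad}(X)}\le C\,\Big\|\sum_{n=1}^N x_n n^{-s}\Big\|_{\mathcal H_p(X)}.$$ (c) $\mathcal H_p(X)\subseteq\mathcal H_p^{rad}(X)$. (d) There is $C\ge 1$ such that for every $N\in\mathbb N$ and all $x_1,\dots,x_N\in X$, $$\mathbb E\Big\|\sum_{n=1}^N\varepsilon_n x_n\Big\|\le C\Big(\int_{\mathbb T}\Big\|\sum_{n=1}^N x_n z^n\Big\|^p\,dz\Big)^{1/p},$$ where $dz$ is the normalized Haar measure of $\mathbb T$. -/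

import Mathlib

open MeasureTheory
open scoped ENNReal NNReal

namespace DirichletRUC

section Torus

/-- The Borel σ-algebra of the unit circle `𝕋`. -/
noncomputable instance circleMeasurableSpace : MeasurableSpace Circle := borel Circle

instance circleBorelSpace : BorelSpace Circle := ⟨rfl⟩

/-- The normalized Haar measure `dz` of the unit circle `𝕋`. -/
noncomputable def circleHaar : Measure Circle := Measure.haarMeasure ⊤

instance circleHaar_isProbabilityMeasure : IsProbabilityMeasure circleHaar :=
  ⟨Measure.haarMeasure_self⟩

/-- The normalized Haar measure of the infinite polytorus `𝕋^ℕ`: the product of the normalized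
Haar measures of the factors. -/
noncomputable def polytorusHaar : Measure (ℕ → Circle) := Measure.infinitePi fun _ => circleHaar

/-- The monomial `z^α`, for a finitely supported sequence of integers `α`. -/
noncomputable def torusMonomial (α : ℕ →₀ ℤ) (z : ℕ → Circle) : Circle := α.prod fun k a => z k ^ a

end Torus

section Signs

/-- The normalized Haar measure of `{-1,+1}^ℕ` (the law of a sequence of independent Rademacher
variables), where `ℤˣ = {1, -1}` and the sequences are indexed by `n = 1, 2, 3, …`. -/
noncomputable def signMeasure : Measure (ℕ+ → ℤˣ) :=
  Measure.infinitePi fun _ => (PMF.uniformOfFintype ℤˣ).toMeasure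

end Signs

section Hardy

variable {X : Type*} [NormedAddCommGroup X] [NormedSpace ℂ X]

/-- The Fourier coefficient `∫ f(w) w^{-α} dw` of `f : 𝕋^ℕ → X`. -/
noncomputable def fourierCoefficient (f : (ℕ → Circle) → X) (α : ℕ →₀ ℤ) : X :=
  ∫ w, ((torusMonomial (-α) w : Circle) : ℂ) • f w ∂polytorusHaar

/-- `f` belongs to `H_p(𝕋^ℕ, X)`: it is `p`-Bochner integrable and its Fourier coefficients
vanish at every multi-index with a negative entry. -/
def MemHardyTorus (p : ℝ) (f : (ℕ → Circle) → X) : Prop :=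
  MemLp f (ENNReal.ofReal p) polytorusHaar ∧
    ∀ α : ℕ →₀ ℤ, (∃ k, α k < 0) → fourierCoefficient f α = 0

/-- The `k`-th prime number (`k = 0, 1, 2, …`, so that `2` is the `0`-th), as a positive
natural number. -/
noncomputable def primeSeq (k : ℕ) : ℕ+ := ⟨Nat.nth Nat.Prime k, (Nat.prime_nth_prime k).pos⟩

/-- The number `n(α) = p₁^{α₁} p₂^{α₂} ⋯`, for a finitely supported sequence of non-negative
integers `α`. -/
noncomputable def bohrIndex (α : ℕ →₀ ℕ) : ℕ+ := α.prod fun k a => primeSeq k ^ a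

/-- A formal Dirichlet series `∑ xₙ n^{-s}` is its sequence of coefficients `(xₙ)`, `n ≥ 1`.
This is the one-term series `x n^{-s}`. -/
def dirichletTerm (n : ℕ+) (x : X) : ℕ+ → X := Pi.single n x

/-- The Dirichlet polynomial `∑_{n=1}^N xₙ n^{-s}`. -/
def dirichletPolynomial (N : ℕ+) (x : ℕ+ → X) : ℕ+ → X :=
  ∑ n ∈ Finset.Icc 1 N, dirichletTerm n (x n)

/-- `D` is the Bohr transform of `f`: the coefficient of `D` at `n(α)` is the Fourier coefficient
of `f` at `α`, for every finitely supported sequence `α` of non-negative integers. -/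
def IsBohrTransform (f : (ℕ → Circle) → X) (D : ℕ+ → X) : Prop :=
  ∀ α : ℕ →₀ ℕ,
    fourierCoefficient f (α.mapRange (fun m : ℕ => (m : ℤ)) Nat.cast_zero) = D (bohrIndex α)

/-- The space `𝓗_p(X)`, as a set of formal Dirichlet series. -/
def dirichletHardy (p : ℝ) : Set (ℕ+ → X) :=
  {D | ∃ f : (ℕ → Circle) → X, MemHardyTorus p f ∧ IsBohrTransform f D}

/-- The norm of `𝓗_p(X)`: the `L_p`-norm of the function in `H_p(𝕋^ℕ, X)` whose Bohr transform is
`D`. This function is unique up to null sets, so the infimum has a single value to range over if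
`D ∈ 𝓗_p(X)`; outside `𝓗_p(X)` it is `∞`. -/
noncomputable def dirichletHardyNorm (p : ℝ) (D : ℕ+ → X) : ℝ≥0∞ :=
  ⨅ (f : (ℕ → Circle) → X) (_ : MemHardyTorus p f ∧ IsBohrTransform f D),
    eLpNorm f (ENNReal.ofReal p) polytorusHaar

/-- The space `𝓗_p^rad(X)`, as a set of formal Dirichlet series: those `∑ xₙ n^{-s}` for which
`∑ εₙ xₙ n^{-s}` belongs to `𝓗_p(X)` for almost every choice of signs. -/
def dirichletHardyRad (p : ℝ) : Set (ℕ+ → X) :=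
  {D | ∀ᵐ ε ∂signMeasure, (fun n => ε n • D n) ∈ dirichletHardy p}

/-- The norm of `𝓗_p^rad(X)`: the expectation of `‖∑ εₙ xₙ n^{-s}‖` in `𝓗_p(X)`. -/
noncomputable def dirichletHardyRadNorm (p : ℝ) (D : ℕ+ → X) : ℝ≥0∞ :=
  ∫⁻ ε, dirichletHardyNorm p (fun n => ε n • D n) ∂signMeasure

end Hardy

section RUC

/-- A sequence `(yₙ)` in a complex vector space `V` is RUC with respect to a norm `ν` on (a
subspace of) `V` if, for a constant `C` and all finite families of scalars `(aₙ)`,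
`𝔼 ν(∑ εₙ aₙ yₙ) ≤ C ν(∑ aₙ yₙ)`. -/
def IsRUC {V : Type*} [AddCommGroup V] [Module ℂ V] (ν : V → ℝ≥0∞) (y : ℕ+ → V) : Prop :=
  ∃ C : ℝ≥0, ∀ (m : ℕ+) (a : ℕ+ → ℂ),
    ∫⁻ ε, ν (∑ n ∈ Finset.Icc 1 m, ε n • a n • y n) ∂signMeasure ≤
      C * ν (∑ n ∈ Finset.Icc 1 m, a n • y n)

end RUC

end DirichletRUC

/-! All four statements are compared with one inequality, `RadBound`, over arbitrary finite index
sets. Unique factorization turns n^{-s} into a character of 𝕋^ℕ and 𝓗_p(X) into the functions in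
L_p(𝕋^ℕ, X) with spectrum in the non-negative multi-indices.

Necessity of the uniform bound is a gliding hump argument. Multiplication by m^{-s} is
multiplication by a unimodular function, hence isometric, so polynomials violating the bound by
factors 4^k can be moved to disjoint blocks and scaled to have norm at most 2^{-k} and Rademacher
mean at least 2^k. This one sequence of coefficients contradicts RUC, and the sum of the blocks lies
in 𝓗_p(X). It is not in 𝓗_p^rad(X): otherwise the Fejér means of almost every sign change are
bounded by the norm of its lift, and a Paley–Zygmund argument with sign symmetry makes the
Rademacher means over all finite index sets bounded.

Conversely, let the uniform bound hold. Fejér means of F along a fast subsequence have summable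
differences; the bound makes the differences of the randomized means summable in expectation, so
these means converge almost surely to a lift of the signed series. Fejér means serve here because
their kernels are positive: they are contractions for every Banach space X and converge in norm,
while partial sums need not be bounded.

For power series, restriction to the powers of 2 gives one direction, the contraction principle
removing the unimodular factors. For the other, a weight B is chosen so that the substitution w_j ↦
z^{B^j} w_j gives the finitely many indices distinct powers of z. It preserves Haar measure for each
z; the circle inequality is applied for each fixed w, and Kahane's inequality, obtained from
hypercontractivity, raises the Rademacher mean to a p-th moment so that Fubini applies. -/

namespace DirichletRUC

/-! ### Rademacher sums: symmetry, reindexing, conditioning -/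

section RademacherSums

/-- The Rademacher sum `∑_{n ∈ S} εₙ yₙ`. -/
def signSum {Y : Type*} [AddCommGroup Y] (S : Finset ℕ+) (y : ℕ+ → Y) (ε : ℕ+ → ℤˣ) : Y :=
  ∑ n ∈ S, ε n • y n

instance : IsProbabilityMeasure signMeasure := by
  unfold signMeasure; infer_instance

instance : MeasurableSingletonClass ℤˣ :=
  ⟨fun u => ⟨{(u : ℤ)}, measurableSet_singleton _, by ext v; simp [Units.ext_iff]⟩⟩

theorem map_mul_left_uniform (u : ℤˣ) :
    (PMF.uniformOfFintype ℤˣ).toMeasure.map (fun v => u * v) =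
      (PMF.uniformOfFintype ℤˣ).toMeasure := by
  refine Measure.ext_of_singleton fun v => ?_
  rw [Measure.map_apply (measurable_of_countable _) (measurableSet_singleton _)]
  have : (fun v => u * v) ⁻¹' {v} = {u⁻¹ * v} := by
    ext w; simp
  rw [this, PMF.toMeasure_apply_singleton _ _ (measurableSet_singleton _),
    PMF.toMeasure_apply_singleton _ _ (measurableSet_singleton _)]
  simp

/-- Changing signs preserves the law of a Rademacher sequence. -/
theorem measurePreserving_mul_signs (s : ℕ+ → ℤˣ) :
    MeasurePreserving (fun ε : ℕ+ → ℤˣ => s * ε) signMeasure signMeasure := by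
  refine ⟨measurable_pi_lambda _ fun i =>
    (measurable_of_countable fun v : ℤˣ => s i * v).comp (measurable_pi_apply i), ?_⟩
  have := Measure.infinitePi_map_pi (fun _ : ℕ+ => (PMF.uniformOfFintype ℤˣ).toMeasure)
    (f := fun i v => s i * v) fun i => measurable_of_countable _
  simp only [map_mul_left_uniform] at this
  exact this

/-- The law of a subsequence of a Rademacher sequence along an injective map. -/
theorem map_signMeasure_comp {ι : Type*} {φ : ι → ℕ+} (hφ : Function.Injective φ) :
    signMeasure.map (fun ε i => ε (φ i)) =
      Measure.infinitePi fun _ : ι => (PMF.uniformOfFintype ℤˣ).toMeasure := by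
  have h := ProbabilityTheory.iIndepFun_infinitePi
    (P := fun _ : ℕ+ => (PMF.uniformOfFintype ℤˣ).toMeasure) (X := fun _ v => v)
    fun _ => measurable_id
  have h' := (ProbabilityTheory.iIndepFun_iff_map_fun_eq_infinitePi_map
    fun i => measurable_pi_apply (φ i)).1 (h.precomp hφ)
  rw [signMeasure, h']
  congr 1
  ext1 i
  exact Measure.infinitePi_map_eval _ _

section Measurability

variable {Y : Type*} [AddCommGroup Y]

theorem signSum_eq_restrict (S : Finset ℕ+) (y : ℕ+ → Y) (ε : ℕ+ → ℤˣ) :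
    signSum S y ε = (fun r : S → ℤˣ => ∑ i : S, r i • y i) (fun i => ε i) :=
  (Finset.sum_coe_sort S fun i => ε i • y i).symm

/-- The sum depends on finitely many signs, so it factors through a finite discrete space; no
measurable structure on `Y` and no regularity of `F` is needed. -/
theorem measurable_comp_signSum {β : Type*} [MeasurableSpace β] (S : Finset ℕ+) (y : ℕ+ → Y)
    (F : Y → β) : Measurable fun ε => F (signSum S y ε) := by
  simp_rw [signSum_eq_restrict]
  exact (measurable_of_countable fun r : S → ℤˣ => F (∑ i : S, r i • y i)).comp
    (measurable_pi_lambda _ fun i => measurable_pi_apply _)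

theorem stronglyMeasurable_comp_signSum {β : Type*} [TopologicalSpace β] (S : Finset ℕ+)
    (y : ℕ+ → Y) (F : Y → β) : StronglyMeasurable fun ε => F (signSum S y ε) := by
  simp_rw [signSum_eq_restrict]
  exact (StronglyMeasurable.of_discrete (f := fun r : S → ℤˣ => F (∑ i : S, r i • y i))).comp_measurable
    (measurable_pi_lambda _ fun i => measurable_pi_apply _)

/-- The law of a Rademacher sum is invariant under injective reindexing. -/
theorem lintegral_signSum_reindex (S : Finset ℕ+) (y : ℕ+ → Y) {φ : ℕ+ → ℕ+}
    (hφ : Set.InjOn φ S) (F : Y → ℝ≥0∞) :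
    ∫⁻ ε, F (∑ n ∈ S, ε (φ n) • y n) ∂signMeasure = ∫⁻ ε, F (signSum S y ε) ∂signMeasure := by
  let G : (S → ℤˣ) → ℝ≥0∞ := fun r => F (∑ i : S, r i • y i)
  have hG : Measurable G := measurable_of_countable _
  have key : ∀ ψ : S → ℕ+, Function.Injective ψ →
      ∫⁻ ε, F (∑ i : S, ε (ψ i) • y i) ∂signMeasure =
        ∫⁻ r, G r ∂(Measure.infinitePi fun _ : S => (PMF.uniformOfFintype ℤˣ).toMeasure) := by
    intro ψ hψ
    rw [← map_signMeasure_comp hψ, lintegral_map hG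
      (measurable_pi_lambda _ fun i => measurable_pi_apply _)]
  have h1 := key (fun i => φ i) fun i j hij => Subtype.ext (hφ i.2 j.2 hij)
  have h2 := key (fun i => i) Subtype.val_injective
  have e1 : ∀ ε : ℕ+ → ℤˣ, ∑ n ∈ S, ε (φ n) • y n = ∑ i : S, ε (φ i) • y i := fun ε =>
    (Finset.sum_coe_sort S fun i => ε (φ i) • y i).symm
  simp_rw [e1, signSum_eq_restrict]
  rw [h1, ← h2]

/-- Conditioning a Rademacher sum on one of its signs. -/
theorem two_mul_lintegral_signSum_insert {n : ℕ+} {S : Finset ℕ+} (hn : n ∉ S) (x : Y)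
    (y : ℕ+ → Y) (F : Y → ℝ≥0∞) :
    2 * ∫⁻ ε, F (x + signSum (insert n S) y ε) ∂signMeasure =
      ∫⁻ ε, F (x + y n + signSum S y ε) ∂signMeasure +
        ∫⁻ ε, F (x - y n + signSum S y ε) ∂signMeasure := by
  classical
  -- One of the two copies of the integral is taken after flipping the n-th sign alone, so that
  -- pointwise both values of that sign occur.
  let s : ℕ+ → ℤˣ := Function.update 1 n (-1)
  have hflip := (measurePreserving_mul_signs s).lintegral_comp
    (measurable_comp_signSum (insert n S) y fun v => F (x + v))
  rw [two_mul]
  nth_rewrite 1 [← hflip]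
  rw [← lintegral_add_right _ (measurable_comp_signSum (insert n S) y fun v => F (x + v)),
    ← lintegral_add_right _ (measurable_comp_signSum S y fun v => F (x - y n + v))]
  refine lintegral_congr fun ε => ?_
  have hS : signSum S y (s * ε) = signSum S y ε := by
    refine Finset.sum_congr rfl fun i hi => ?_
    have : i ≠ n := fun h => hn (h ▸ hi)
    simp [s, this]
  have h1 : signSum (insert n S) y (s * ε) = -(ε n • y n) + signSum S y ε := by
    rw [← hS, signSum, Finset.sum_insert hn]
    simp [s, signSum]
  have h2 : signSum (insert n S) y ε = ε n • y n + signSum S y ε := by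
    rw [signSum, Finset.sum_insert hn]; rfl
  rw [h1, h2, ← add_assoc, ← add_assoc]
  rcases Int.units_eq_one_or (ε n) with h | h <;> simp [h, sub_eq_add_neg, add_comm]

end Measurability

end RademacherSums

/-! ### Contraction principle, hypercontractivity and Kahane's inequality -/

section Kahane

variable {Y : Type*} [NormedAddCommGroup Y] [NormedSpace ℝ Y]

theorem signSum_smul (S : Finset ℕ+) (a : ℝ) (y : ℕ+ → Y) (ε : ℕ+ → ℤˣ) :
    signSum S (fun n => a • y n) ε = a • signSum S y ε := by
  rw [signSum, signSum, Finset.smul_sum]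
  exact Finset.sum_congr rfl fun n _ => smul_comm _ _ _

theorem lintegral_enorm_signSum_lt_top {Y : Type*} [NormedAddCommGroup Y] (S : Finset ℕ+)
    (y : ℕ+ → Y) :
    ∫⁻ ε, ‖signSum S y ε‖ₑ ∂signMeasure < ∞ := by
  have : ∀ ε, ‖signSum S y ε‖ₑ ≤ ∑ n ∈ S, ‖y n‖ₑ := fun ε => by
    refine (enorm_sum_le _ _).trans (Finset.sum_le_sum fun n _ => ?_)
    rcases Int.units_eq_one_or (ε n) with h | h <;> simp [h]
  refine (lintegral_mono this).trans_lt ?_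
  simp [ENNReal.sum_lt_top]

/-- Convexity: `u ± a • v` are convex combinations of `u + v` and `u - v` with weights (1 ± a)/2. -/
theorem enorm_add_smul_add_enorm_sub_smul_le {a : ℝ} (ha : |a| ≤ 1) (u v : Y) :
    ‖u + a • v‖ₑ + ‖u - a • v‖ₑ ≤ ‖u + v‖ₑ + ‖u - v‖ₑ := by
  obtain ⟨h1, h2⟩ := abs_le.1 ha
  have key : ‖u + a • v‖ + ‖u - a • v‖ ≤ ‖u + v‖ + ‖u - v‖ := by
    have e1 : u + a • v = ((1 + a) / 2) • (u + v) + ((1 - a) / 2) • (u - v) := by module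
    have e2 : u - a • v = ((1 - a) / 2) • (u + v) + ((1 + a) / 2) • (u - v) := by module
    have n1 := norm_add_le (((1 + a) / 2) • (u + v)) (((1 - a) / 2) • (u - v))
    have n2 := norm_add_le (((1 - a) / 2) • (u + v)) (((1 + a) / 2) • (u - v))
    rw [← e1, norm_smul, norm_smul, Real.norm_of_nonneg (by linarith),
      Real.norm_of_nonneg (by linarith)] at n1
    rw [← e2, norm_smul, norm_smul, Real.norm_of_nonneg (by linarith),
      Real.norm_of_nonneg (by linarith)] at n2
    linarith
  simp only [← ofReal_norm]
  rw [← ENNReal.ofReal_add (by positivity) (by positivity),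
    ← ENNReal.ofReal_add (by positivity) (by positivity)]
  exact ENNReal.ofReal_le_ofReal key

/-- The contraction principle for real multipliers. -/
theorem lintegral_enorm_signSum_contraction (S : Finset ℕ+) {a : ℕ+ → ℝ} (ha : ∀ n, |a n| ≤ 1)
    (x : Y) (y : ℕ+ → Y) :
    ∫⁻ ε, ‖x + signSum S (fun n => a n • y n) ε‖ₑ ∂signMeasure ≤
      ∫⁻ ε, ‖x + signSum S y ε‖ₑ ∂signMeasure := by
  classical
  induction S using Finset.induction_on generalizing x with
  | empty => simp [signSum]
  | insert n S hn ih =>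
    refine (ENNReal.mul_le_mul_iff_right two_ne_zero ENNReal.ofNat_ne_top).1 ?_
    rw [two_mul_lintegral_signSum_insert hn x _ (fun v => ‖v‖ₑ),
      two_mul_lintegral_signSum_insert hn x _ (fun v => ‖v‖ₑ)]
    refine (add_le_add (ih _) (ih _)).trans ?_
    rw [← lintegral_add_right _ (measurable_comp_signSum S y fun v => ‖x - a n • y n + v‖ₑ),
      ← lintegral_add_right _ (measurable_comp_signSum S y fun v => ‖x - y n + v‖ₑ)]
    refine lintegral_mono fun ε => ?_
    have := enorm_add_smul_add_enorm_sub_smul_le (ha n) (x + signSum S y ε) (y n)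
    simpa [add_right_comm, add_sub_right_comm] using this

/-- The contraction principle for unimodular complex multipliers. -/
theorem lintegral_enorm_signSum_le_of_unimodular {X : Type*} [NormedAddCommGroup X]
    [NormedSpace ℂ X] (S : Finset ℕ+) {a : ℕ+ → ℂ} (ha : ∀ n, ‖a n‖ = 1) (y : ℕ+ → X) :
    ∫⁻ ε, ‖signSum S y ε‖ₑ ∂signMeasure ≤
      2 * ∫⁻ ε, ‖signSum S (fun n => a n • y n) ε‖ₑ ∂signMeasure := by
  -- Multiplication by the conjugates undoes that by `a`. Their real and imaginary parts are real
  -- multipliers bounded by 1, which produces the constant 2.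
  let b : ℕ+ → ℂ := fun n => starRingEnd ℂ (a n)
  let z : ℕ+ → X := fun n => a n • y n
  have hre : ∀ n, |(b n).re| ≤ 1 := fun n =>
    (Complex.abs_re_le_norm _).trans (by simp [b, ha])
  have him : ∀ n, |(b n).im| ≤ 1 := fun n =>
    (Complex.abs_im_le_norm _).trans (by simp [b, ha])
  have hy : ∀ n, y n = (b n).re • z n + Complex.I • ((b n).im • z n) := fun n => by
    have h1 : b n • z n = y n := by
      simp only [b, z, smul_smul]
      rw [mul_comm, Complex.mul_conj, Complex.normSq_eq_norm_sq, ha]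
      simp
    rw [← h1]
    conv_lhs => rw [← Complex.re_add_im (b n), add_smul, mul_comm, mul_smul]
    simp
  have hsum : ∀ ε, signSum S y ε = signSum S (fun n => (b n).re • z n) ε +
      Complex.I • signSum S (fun n => (b n).im • z n) ε := fun ε => by
    simp only [signSum, Finset.smul_sum, ← Finset.sum_add_distrib]
    refine Finset.sum_congr rfl fun n _ => ?_
    conv_lhs => rw [hy n]
    rw [smul_add, smul_comm (ε n) Complex.I]
  have hc : ∀ c : ℕ+ → ℝ, (∀ n, |c n| ≤ 1) →
      ∫⁻ ε, ‖signSum S (fun n => c n • z n) ε‖ₑ ∂signMeasure ≤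
        ∫⁻ ε, ‖signSum S z ε‖ₑ ∂signMeasure := fun c h => by
    simpa using lintegral_enorm_signSum_contraction S h (0 : X) z
  calc ∫⁻ ε, ‖signSum S y ε‖ₑ ∂signMeasure
      ≤ ∫⁻ ε, (‖signSum S (fun n => (b n).re • z n) ε‖ₑ +
          ‖signSum S (fun n => (b n).im • z n) ε‖ₑ) ∂signMeasure := by
        refine lintegral_mono fun ε => ?_
        rw [hsum]
        refine (enorm_add_le _ _).trans (le_of_eq ?_)
        rw [enorm_smul]
        simp [← ofReal_norm]
    _ ≤ _ := by
        rw [lintegral_add_right _ (measurable_comp_signSum S _ fun v => ‖v‖ₑ), two_mul]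
        exact add_le_add (hc _ hre) (hc _ him)

/-- The even and odd parts of `(u + w) ^ (2 * k)`. -/
theorem pow_add_sub_pow_bounds (u w : ℝ) (k : ℕ) :
    0 ≤ u * w * (((u + w) ^ 2) ^ k - ((u - w) ^ 2) ^ k) ∧
      u * w * (((u + w) ^ 2) ^ k - ((u - w) ^ 2) ^ k) ≤
        2 * k * w ^ 2 * (((u + w) ^ 2) ^ k + ((u - w) ^ 2) ^ k) := by
  induction k with
  | zero => simp
  | succ k ih =>
    obtain ⟨h0, h1⟩ := ih
    set A := ((u + w) ^ 2) ^ k with hA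
    set B := ((u - w) ^ 2) ^ k with hB
    have hA0 : 0 ≤ A := by positivity
    have hB0 : 0 ≤ B := by positivity
    have e1 : u * w * (A * (u + w) ^ 2 - B * (u - w) ^ 2) =
        (u ^ 2 + w ^ 2) * (u * w * (A - B)) + 2 * (u * w) ^ 2 * (A + B) := by ring
    have e2 : A * (u + w) ^ 2 + B * (u - w) ^ 2 =
        (u ^ 2 + w ^ 2) * (A + B) + 2 * (u * w * (A - B)) := by ring
    rw [pow_succ (_ ^ 2) k, pow_succ (_ ^ 2) k, ← hA, ← hB, e1, e2]
    refine ⟨by positivity, ?_⟩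
    push_cast
    have h2 : (u ^ 2 + w ^ 2) * (u * w * (A - B)) ≤
        (u ^ 2 + w ^ 2) * (2 * k * w ^ 2 * (A + B)) :=
      mul_le_mul_of_nonneg_left h1 (by positivity)
    have h3 : 0 ≤ 2 * ((k : ℝ) + 1) * w ^ 2 * (2 * (u * w * (A - B))) := by positivity
    have h4 : 0 ≤ 2 * w ^ 2 * w ^ 2 * (A + B) := by positivity
    nlinarith

/-- In the step from k to k + 1 the cross term 2uw(A - B) is at most 4kw²(A + B), so the sum grows
by a factor of at most u² + (1 + 4k)w², and 1 + 4k ≤ 4m. -/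
theorem pow_add_pow_sub_le (u w : ℝ) {k m : ℕ} (hk : k ≤ m) :
    ((u + w) ^ 2) ^ k + ((u - w) ^ 2) ^ k ≤ 2 * (u ^ 2 + 4 * m * w ^ 2) ^ k := by
  induction k with
  | zero => norm_num
  | succ k ih =>
    have ih := ih (by omega)
    obtain ⟨h0, h1⟩ := pow_add_sub_pow_bounds u w k
    have hk' : (k : ℝ) + 1 ≤ m := by exact_mod_cast hk
    set A := ((u + w) ^ 2) ^ k with hA
    set B := ((u - w) ^ 2) ^ k with hB
    have hA0 : 0 ≤ A := by positivity
    have hB0 : 0 ≤ B := by positivity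
    rw [pow_succ (_ ^ 2) k, pow_succ (_ ^ 2) k, ← hA, ← hB, pow_succ _ k]
    have h2 : A * (u + w) ^ 2 + B * (u - w) ^ 2 ≤ (u ^ 2 + 4 * m * w ^ 2) * (A + B) := by
      have : 0 ≤ (4 * (m : ℝ) - 1 - 4 * k) * w ^ 2 * (A + B) := by
        have : 0 ≤ 4 * (m : ℝ) - 1 - 4 * k := by linarith
        positivity
      nlinarith
    have h3 : (u ^ 2 + 4 * m * w ^ 2) * (A + B) ≤
        (u ^ 2 + 4 * m * w ^ 2) * (2 * (u ^ 2 + 4 * m * w ^ 2) ^ k) :=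
      mul_le_mul_of_nonneg_left ih (by positivity)
    linarith

/-- The two-point hypercontractive inequality from `L²` to `L²ᵐ`. -/
theorem two_point_inequality {m : ℕ} (hm : 1 ≤ m) (a b : ℝ) :
    ((1 + 1 / (2 * m)) / 2 * a + (1 - 1 / (2 * m)) / 2 * b) ^ (2 * m) +
      ((1 - 1 / (2 * m)) / 2 * a + (1 + 1 / (2 * m)) / 2 * b) ^ (2 * m) ≤
        2 * ((a ^ 2 + b ^ 2) / 2) ^ m := by
  have hm' : (1 : ℝ) ≤ m := by exact_mod_cast hm
  have h := pow_add_pow_sub_le ((a + b) / 2) (1 / (2 * m) * ((a - b) / 2)) (le_refl m)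
  rw [← pow_mul, ← pow_mul] at h
  have e1 : (1 + 1 / (2 * (m : ℝ))) / 2 * a + (1 - 1 / (2 * m)) / 2 * b =
    (a + b) / 2 + 1 / (2 * m) * ((a - b) / 2) := by ring
  have e2 : (1 - 1 / (2 * (m : ℝ))) / 2 * a + (1 + 1 / (2 * m)) / 2 * b =
    (a + b) / 2 - 1 / (2 * m) * ((a - b) / 2) := by ring
  rw [e1, e2]
  refine h.trans ?_
  gcongr
  -- This fixes the contraction parameter: ρ = 1/(2m) satisfies 4mρ² = 1/m ≤ 1.
  have e3 : 4 * (m : ℝ) * (1 / (2 * m) * ((a - b) / 2)) ^ 2 = 1 / m * ((a - b) / 2) ^ 2 := by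
    field_simp
    ring
  have h4 : 1 / (m : ℝ) ≤ 1 := by
    rw [div_le_one (by linarith)]; exact hm'
  have h5 := mul_le_mul_of_nonneg_right h4 (sq_nonneg ((a - b) / 2))
  rw [e3]
  nlinarith

/-- The form used in the tensorization: `a`, `b` will be the L²ᵐ norms of f ± y, `s`, `t` those of f
± ρy, and `J` a second moment. -/
theorem two_point_inequality_ennreal {m : ℕ} (hm : 1 ≤ m) {a b s t J : ℝ≥0∞}
    (hs : s ≤ ENNReal.ofReal ((1 + 1 / (2 * m)) / 2) * a +
      ENNReal.ofReal ((1 - 1 / (2 * m)) / 2) * b)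
    (ht : t ≤ ENNReal.ofReal ((1 - 1 / (2 * m)) / 2) * a +
      ENNReal.ofReal ((1 + 1 / (2 * m)) / 2) * b)
    (hJ : a ^ 2 + b ^ 2 ≤ 2 * J) : s ^ (2 * m) + t ^ (2 * m) ≤ 2 * J ^ m := by
  rcases eq_or_ne J ∞ with rfl | hJ'
  · rw [ENNReal.top_pow (by omega), ENNReal.mul_top two_ne_zero]
    exact le_top
  have hab : a ^ 2 + b ^ 2 ≠ ∞ := (hJ.trans_lt (ENNReal.mul_lt_top (by simp) hJ'.lt_top)).ne
  rw [ENNReal.add_ne_top] at hab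
  have ha : a ≠ ∞ := fun h => hab.1 (by simp [h])
  have hb : b ≠ ∞ := fun h => hab.2 (by simp [h])
  lift a to ℝ≥0 using ha
  lift b to ℝ≥0 using hb
  lift J to ℝ≥0 using hJ'
  have hm' : (1 : ℝ) ≤ m := by exact_mod_cast hm
  have h4 : 1 / (2 * (m : ℝ)) ≤ 1 := by
    rw [div_le_one (by linarith)]; linarith
  have h5 : 0 ≤ 1 / (2 * (m : ℝ)) := by positivity
  have hc1 : 0 ≤ (1 + 1 / (2 * (m : ℝ))) / 2 := by linarith
  have hc2 : 0 ≤ (1 - 1 / (2 * (m : ℝ))) / 2 := by linarith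
  have key := two_point_inequality hm a b
  have hJr : (a : ℝ) ^ 2 + (b : ℝ) ^ 2 ≤ 2 * J := by exact_mod_cast hJ
  have e : ∀ {c d : ℝ}, 0 ≤ c → 0 ≤ d → ENNReal.ofReal c * (a : ℝ≥0∞) + ENNReal.ofReal d * b =
      ENNReal.ofReal (c * a + d * b) := fun {c d} hc hd => by
    rw [ENNReal.ofReal_add (by positivity) (by positivity), ENNReal.ofReal_mul hc,
      ENNReal.ofReal_mul hd]
    simp
  rw [e hc1 hc2] at hs
  rw [e hc2 hc1] at ht
  refine (add_le_add (pow_le_pow_left' hs _) (pow_le_pow_left' ht _)).trans ?_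
  rw [← ENNReal.ofReal_pow (by positivity), ← ENNReal.ofReal_pow (by positivity),
    ← ENNReal.ofReal_add (by positivity) (by positivity)]
  have : (2 * (J : ℝ≥0∞) ^ m) = ENNReal.ofReal (2 * (J : ℝ) ^ m) := by
    rw [ENNReal.ofReal_mul (by norm_num), ENNReal.ofReal_pow (by positivity)]
    simp
  rw [this]
  refine ENNReal.ofReal_le_ofReal (key.trans ?_)
  gcongr
  linarith

theorem eLpNorm_pow_eq_lintegral {Y : Type*} [NormedAddCommGroup Y] {Ω : Type*}
    [MeasurableSpace Ω] {μ : Measure Ω} {k : ℕ}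
    (hk : k ≠ 0) (f : Ω → Y) : eLpNorm f k μ ^ k = ∫⁻ ω, ‖f ω‖ₑ ^ k ∂μ := by
  have := eLpNorm_nnreal_pow_eq_lintegral (f := f) (μ := μ) (p := (k : ℝ≥0)) (by exact_mod_cast hk)
  simpa using this

theorem eLpNorm_add_smul_le {Ω : Type*} [MeasurableSpace Ω] {μ : Measure Ω} {q : ℝ≥0∞}
    (hq : 1 ≤ q) {ρ : ℝ} (h0 : 0 ≤ ρ) (h1 : ρ ≤ 1) {f : Ω → Y} (hf : AEStronglyMeasurable f μ)
    (y : Y) : eLpNorm (fun ω => f ω + ρ • y) q μ ≤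
      ENNReal.ofReal ((1 + ρ) / 2) * eLpNorm (fun ω => f ω + y) q μ +
        ENNReal.ofReal ((1 - ρ) / 2) * eLpNorm (fun ω => f ω - y) q μ := by
  have hadd : AEStronglyMeasurable (fun ω => f ω + y) μ := hf.add aestronglyMeasurable_const
  have hsub : AEStronglyMeasurable (fun ω => f ω - y) μ := hf.sub aestronglyMeasurable_const
  have e : (fun ω => f ω + ρ • y) =
      ((1 + ρ) / 2) • (fun ω => f ω + y) + ((1 - ρ) / 2) • fun ω => f ω - y := by
    ext ω
    simp only [Pi.add_apply, Pi.smul_apply]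
    module
  rw [e]
  refine (eLpNorm_add_le (hadd.const_smul _) (hsub.const_smul _) hq).trans (le_of_eq ?_)
  rw [eLpNorm_const_smul, eLpNorm_const_smul, Real.enorm_of_nonneg (by linarith),
    Real.enorm_of_nonneg (by linarith)]

/-- Hypercontractivity of Rademacher sums. -/
theorem lintegral_signSum_hypercontractive {m : ℕ} (hm : 1 ≤ m) (S : Finset ℕ+) (x : Y)
    (y : ℕ+ → Y) :
    ∫⁻ ε, ‖x + signSum S (fun n => (1 / (2 * m) : ℝ) • y n) ε‖ₑ ^ (2 * m) ∂signMeasure ≤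
      (∫⁻ ε, ‖x + signSum S y ε‖ₑ ^ 2 ∂signMeasure) ^ m := by
  classical
  have hm' : (1 : ℝ) ≤ m := by exact_mod_cast hm
  have h1 : 1 / (2 * (m : ℝ)) ≤ 1 := by
    rw [div_le_one (by linarith)]; linarith
  have h0 : 0 ≤ 1 / (2 * (m : ℝ)) := by positivity
  induction S using Finset.induction_on generalizing x with
  | empty => simp [signSum, pow_mul]
  | insert n S hn ih =>
    set ρ : ℝ := 1 / (2 * m) with hρ
    refine (ENNReal.mul_le_mul_iff_right two_ne_zero ENNReal.ofNat_ne_top).1 ?_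
    rw [two_mul_lintegral_signSum_insert hn x _ (fun v => ‖v‖ₑ ^ (2 * m))]
    -- Tensorization: the induction hypothesis at the base points x ± y n controls f ± y n in L²ᵐ,
    -- convexity of the norm passes to f ± ρ y n, and the two-point inequality averages over the new
    -- sign.
    let f : (ℕ+ → ℤˣ) → Y := fun ε => x + signSum S (fun n => ρ • y n) ε
    have hf : AEStronglyMeasurable f signMeasure :=
      (stronglyMeasurable_comp_signSum S _ fun v => x + v).aestronglyMeasurable
    have hq : (1 : ℝ≥0∞) ≤ ((2 * m : ℕ) : ℝ≥0∞) := by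
      exact_mod_cast (by omega : 1 ≤ 2 * m)
    have hq0 : 2 * m ≠ 0 := by omega
    have hA : eLpNorm (fun ε => f ε + y n) (2 * m : ℕ) signMeasure ^ 2 ≤
        ∫⁻ ε, ‖x + y n + signSum S y ε‖ₑ ^ 2 ∂signMeasure := by
      refine (ENNReal.pow_le_pow_left_iff (n := m) (by omega)).1 ?_
      rw [← pow_mul, eLpNorm_pow_eq_lintegral hq0]
      refine le_trans (le_of_eq ?_) (ih (x + y n))
      simp [f, add_right_comm]
    have hB : eLpNorm (fun ε => f ε - y n) (2 * m : ℕ) signMeasure ^ 2 ≤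
        ∫⁻ ε, ‖x - y n + signSum S y ε‖ₑ ^ 2 ∂signMeasure := by
      refine (ENNReal.pow_le_pow_left_iff (n := m) (by omega)).1 ?_
      rw [← pow_mul, eLpNorm_pow_eq_lintegral hq0]
      refine le_trans (le_of_eq ?_) (ih (x - y n))
      simp [f, add_sub_right_comm]
    have hs := eLpNorm_add_smul_le hq h0 h1 hf (y n)
    have ht := eLpNorm_add_smul_le hq h0 h1 hf (-y n)
    simp only [sub_neg_eq_add, ← sub_eq_add_neg, smul_neg] at ht
    rw [add_comm] at ht
    have := two_point_inequality_ennreal hm hs ht ((add_le_add hA hB).trans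
      (two_mul_lintegral_signSum_insert hn x y (fun v => ‖v‖ₑ ^ 2)).ge)
    rw [eLpNorm_pow_eq_lintegral hq0, eLpNorm_pow_eq_lintegral hq0] at this
    simpa [f, add_right_comm, add_sub_right_comm] using this

/-- With base point 0 in hypercontractivity, the parameter 1/(2m) scales out by homogeneity. -/
theorem lintegral_signSum_pow_le {m : ℕ} (hm : 1 ≤ m) (S : Finset ℕ+) (y : ℕ+ → Y) :
    ∫⁻ ε, ‖signSum S y ε‖ₑ ^ (2 * m) ∂signMeasure ≤
      (2 * m) ^ (2 * m) * (∫⁻ ε, ‖signSum S y ε‖ₑ ^ 2 ∂signMeasure) ^ m := by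
  have h := lintegral_signSum_hypercontractive hm S 0 y
  have hm' : (0 : ℝ) < m := by exact_mod_cast hm
  simp only [zero_add] at h
  refine le_trans (le_of_eq ?_) (mul_le_mul_right h ((2 * m : ℝ≥0∞) ^ (2 * m)))
  rw [← lintegral_const_mul _ (measurable_comp_signSum S _ fun v => ‖v‖ₑ ^ (2 * m))]
  refine lintegral_congr fun ε => ?_
  rw [signSum_smul, enorm_smul, mul_pow _ ‖signSum S y ε‖ₑ, ← mul_assoc, ← mul_pow,
    Real.enorm_of_nonneg (by positivity), one_div, ENNReal.ofReal_inv_of_pos (by positivity),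
    ENNReal.ofReal_mul (by norm_num), ENNReal.ofReal_natCast, ENNReal.ofReal_ofNat,
    ENNReal.mul_inv_cancel (by simp; omega) (by finiteness), one_pow, one_mul]

/-- Kahane's inequality between the second and the first moment. -/
theorem lintegral_signSum_sq_le (S : Finset ℕ+) (y : ℕ+ → Y) :
    ∫⁻ ε, ‖signSum S y ε‖ₑ ^ 2 ∂signMeasure ≤
      256 * (∫⁻ ε, ‖signSum S y ε‖ₑ ∂signMeasure) ^ 2 := by
  set J1 := ∫⁻ ε, ‖signSum S y ε‖ₑ ∂signMeasure with hJ1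
  set J2 := ∫⁻ ε, ‖signSum S y ε‖ₑ ^ 2 ∂signMeasure with hJ2
  have h4 := lintegral_signSum_pow_le (m := 2) (by norm_num) S y
  norm_num at h4
  rw [← hJ2] at h4
  -- Hölder interpolation of the second moment between the first and the fourth. The fourth is at
  -- most 4⁴ J2², hence J2³ ≤ 256 J1² J2², and the finite factor J2² cancels when it is nonzero.
  have hi := ENNReal.lintegral_mul_norm_pow_le (μ := signMeasure)
    (measurable_comp_signSum S y fun v => ‖v‖ₑ).aemeasurable
    (measurable_comp_signSum S y fun v => ‖v‖ₑ ^ 4).aemeasurable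
    (p := 2 / 3) (q := 1 / 3) (by norm_num) (by norm_num) (by norm_num)
  have e : ∀ a : ℝ≥0∞, a ^ (2 / 3 : ℝ) * (a ^ 4) ^ (1 / 3 : ℝ) = a ^ 2 := fun a => by
    rw [← ENNReal.rpow_natCast, ← ENNReal.rpow_mul, ← ENNReal.rpow_add_of_nonneg _ _ (by norm_num)
      (by norm_num), ← ENNReal.rpow_natCast]
    norm_num
  simp only [e] at hi
  rw [← hJ1, ← hJ2] at hi
  have h3 : J2 ^ 3 ≤ J1 ^ 2 * (256 * J2 ^ 2) := by
    calc J2 ^ 3 ≤ (J1 ^ (2 / 3 : ℝ) *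
          (∫⁻ ε, ‖signSum S y ε‖ₑ ^ 4 ∂signMeasure) ^ (1 / 3 : ℝ)) ^ 3 := pow_le_pow_left' hi 3
      _ = J1 ^ 2 * ∫⁻ ε, ‖signSum S y ε‖ₑ ^ 4 ∂signMeasure := by
        rw [mul_pow, ← ENNReal.rpow_natCast, ← ENNReal.rpow_mul, ← ENNReal.rpow_natCast,
          ← ENNReal.rpow_mul, ← ENNReal.rpow_natCast]
        norm_num
      _ ≤ _ := by gcongr
  have hfin : J2 ≠ ∞ := by
    have : ∀ ε, ‖signSum S y ε‖ₑ ^ 2 ≤ (∑ n ∈ S, ‖y n‖ₑ) ^ 2 := fun ε => by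
      gcongr
      refine (enorm_sum_le _ _).trans (Finset.sum_le_sum fun n _ => ?_)
      rcases Int.units_eq_one_or (ε n) with h | h <;> simp [h]
    refine ((lintegral_mono this).trans_lt ?_).ne
    simp [ENNReal.sum_lt_top]
  rcases eq_or_ne J2 0 with h0 | h0
  · simp [h0]
  have hsq : J2 ^ 2 * J2 ≤ J2 ^ 2 * (256 * J1 ^ 2) := by
    calc J2 ^ 2 * J2 = J2 ^ 3 := by ring
      _ ≤ _ := h3
      _ = _ := by ring
  exact (ENNReal.mul_le_mul_iff_right (by simpa using h0) (by simpa using hfin)).1 hsq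

/-- Kahane's inequality. -/
theorem exists_eLpNorm_signSum_le (Y : Type*) [NormedAddCommGroup Y] [NormedSpace ℝ Y] (p : ℝ) :
    ∃ K : ℝ≥0, ∀ (S : Finset ℕ+) (y : ℕ+ → Y),
      eLpNorm (signSum S y) (ENNReal.ofReal p) signMeasure ≤
        K * ∫⁻ ε, ‖signSum S y ε‖ₑ ∂signMeasure := by
  obtain ⟨m, hm⟩ := exists_nat_ge p
  have hm1 : 1 ≤ m + 1 := by omega
  -- The factor 2(m + 1) comes from hypercontractivity at an even exponent above p, and 16 is the
  -- root of the constant 256 between the second and first moments.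
  refine ⟨(2 * (m + 1)) * 16, fun S y => ?_⟩
  have hle : ENNReal.ofReal p ≤ ((2 * (m + 1) : ℕ) : ℝ≥0∞) := by
    rw [← ENNReal.ofReal_natCast]
    refine ENNReal.ofReal_le_ofReal ?_
    push_cast
    have : (0 : ℝ) ≤ m := by positivity
    linarith
  refine (eLpNorm_le_eLpNorm_of_exponent_le hle
    (stronglyMeasurable_comp_signSum S y id).aestronglyMeasurable).trans ?_
  refine (ENNReal.pow_le_pow_left_iff (n := 2 * (m + 1)) (by omega)).1 ?_
  rw [eLpNorm_pow_eq_lintegral (by omega)]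
  refine (lintegral_signSum_pow_le hm1 S y).trans ?_
  push_cast
  rw [mul_assoc (2 * ((m : ℝ≥0∞) + 1)) 16, mul_pow (2 * ((m : ℝ≥0∞) + 1)) (16 * _),
    pow_mul (16 * _) 2, mul_pow 16]
  refine mul_le_mul_right (pow_le_pow_left' ?_ _) _
  refine (lintegral_signSum_sq_le S y).trans (le_of_eq ?_)
  norm_num

end Kahane

/-! ### From almost sure boundedness to boundedness in mean -/

section Boundedness

variable {Y : Type*} [NormedAddCommGroup Y] [NormedSpace ℝ Y]

/-- A Paley–Zygmund estimate for Rademacher sums. -/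
theorem lintegral_enorm_signSum_le_of_measure_le (S : Finset ℕ+) (y : ℕ+ → Y) (t : ℝ≥0∞)
    (ht : signMeasure {ε | t < ‖signSum S y ε‖ₑ} ≤ 1 / 1024) :
    ∫⁻ ε, ‖signSum S y ε‖ₑ ∂signMeasure ≤ 2 * t := by
  set A := {ε | t < ‖signSum S y ε‖ₑ} with hA
  have hAm : MeasurableSet A :=
    measurableSet_lt measurable_const (measurable_comp_signSum S y fun v => ‖v‖ₑ)
  set J := ∫⁻ ε, ‖signSum S y ε‖ₑ ∂signMeasure with hJ
  have hJfin : J ≠ ∞ := (lintegral_enorm_signSum_lt_top S y).ne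
  -- Cauchy–Schwarz on the tail event: its contribution is at most (256 J² / 1024)^{1/2} = J/2,
  -- absorbed on the left because J is finite.
  have h1 := ENNReal.lintegral_mul_norm_pow_le (μ := signMeasure)
    (measurable_comp_signSum S y fun v => ‖v‖ₑ ^ 2).aemeasurable
    (g := A.indicator 1) (measurable_const.indicator hAm).aemeasurable
    (p := 1 / 2) (q := 1 / 2) (by norm_num) (by norm_num) (by norm_num)
  rw [lintegral_indicator_one hAm] at h1
  have h2 : J ≤ t + ∫⁻ ε, (‖signSum S y ε‖ₑ ^ 2) ^ (1 / 2 : ℝ) *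
      (A.indicator 1 ε : ℝ≥0∞) ^ (1 / 2 : ℝ) ∂signMeasure := by
    have : t = ∫⁻ _, t ∂signMeasure := by simp
    conv_rhs => rw [this]
    rw [← lintegral_add_left measurable_const]
    refine lintegral_mono fun ε => ?_
    by_cases h : ε ∈ A
    · refine le_trans (le_of_eq ?_) le_add_self
      simp only [h, Set.indicator_of_mem, Pi.one_apply, ENNReal.one_rpow, mul_one]
      rw [← ENNReal.rpow_natCast, ← ENNReal.rpow_mul]
      norm_num
    · exact (not_lt.1 h).trans le_self_add
  have h3 : (∫⁻ ε, ‖signSum S y ε‖ₑ ^ 2 ∂signMeasure) ^ (1 / 2 : ℝ) *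
      signMeasure A ^ (1 / 2 : ℝ) ≤ J / 2 := by
    rw [← ENNReal.mul_rpow_of_nonneg _ _ (by norm_num)]
    calc _ ≤ (256 * J ^ 2 * (1 / 1024)) ^ (1 / 2 : ℝ) := by
          gcongr
          exact lintegral_signSum_sq_le S y
      _ = ((J / 2) ^ 2) ^ (1 / 2 : ℝ) := by
          congr 1
          have : (256 : ℝ≥0∞) * (1 / 1024) = (1 / 2) ^ 2 := by
            rw [← ENNReal.toReal_eq_toReal_iff' (by finiteness) (by finiteness)]
            simp
            norm_num
          rw [mul_right_comm, this, ← mul_pow, one_div, ENNReal.div_eq_inv_mul]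
      _ = J / 2 := by
          rw [← ENNReal.rpow_natCast, ← ENNReal.rpow_mul]
          norm_num
  have h4 : J ≤ t + J / 2 := h2.trans (add_le_add le_rfl (h1.trans h3))
  have h5 : J / 2 + J / 2 ≤ t + J / 2 := by rwa [ENNReal.add_halves]
  have h6 : J / 2 ≤ t := ENNReal.le_of_add_le_add_right (ENNReal.div_lt_top hJfin (by simp)).ne h5
  calc J = 2 * (J / 2) := by rw [ENNReal.mul_div_cancel (by simp) (by simp)]
    _ ≤ 2 * t := by gcongr

/-- If a summation method applied to the random series `∑ εₙ yₙ` is almost surely bounded, then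
the partial sums are bounded in mean. -/
theorem exists_lintegral_signSum_le_of_ae_bounded (y : ℕ+ → Y) (T : ℕ → Finset ℕ+)
    (c : ℕ → ℕ+ → ℝ) (hcT : ∀ j, ∀ n ∉ T j, c j n = 0)
    (hc : ∀ n, Filter.Tendsto (fun j => c j n) Filter.atTop (nhds 1))
    (hb : ∀ᵐ ε ∂signMeasure, ∃ M : ℝ≥0, ∀ j, ‖signSum (T j) (fun n => c j n • y n) ε‖ₑ ≤ M) :
    ∃ M : ℝ≥0, ∀ S : Finset ℕ+, ∫⁻ ε, ‖signSum S y ε‖ₑ ∂signMeasure ≤ M := by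
  classical
  let V : ℕ → (ℕ+ → ℤˣ) → Y := fun j => signSum (T j) fun n => c j n • y n
  let M : (ℕ+ → ℤˣ) → ℝ≥0∞ := fun ε => ⨆ j, ‖V j ε‖ₑ
  have hM : Measurable M := .iSup fun j => measurable_comp_signSum _ _ fun v => ‖v‖ₑ
  have hfin : ∀ᵐ ε ∂signMeasure, M ε < ∞ := by
    filter_upwards [hb] with ε ⟨K, hK⟩
    exact (iSup_le hK).trans_lt ENNReal.coe_lt_top
  have hset : ∀ k : ℕ, MeasurableSet {ε | (k : ℝ≥0∞) < M ε} := fun k =>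
    measurableSet_lt measurable_const hM
  have htend := tendsto_measure_iInter_atTop (μ := signMeasure)
    (s := fun k : ℕ => {ε | (k : ℝ≥0∞) < M ε}) (fun k => (hset k).nullMeasurableSet)
    (fun k l hkl ε (hε : (l : ℝ≥0∞) < M ε) => lt_of_le_of_lt (Nat.cast_le.2 hkl) hε) ⟨0, measure_ne_top _ _⟩
  have hzero : signMeasure (⋂ k : ℕ, {ε | (k : ℝ≥0∞) < M ε}) = 0 := by
    refine measure_mono_null (fun ε hε => ?_) (ae_iff.1 hfin)
    simp only [Set.mem_iInter, Set.mem_ofPred_eq] at hε ⊢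
    intro h
    obtain ⟨k, hk⟩ := ENNReal.exists_nat_gt h.ne
    exact lt_asymm hk (hε k)
  rw [hzero] at htend
  -- Half of 1/1024: the tail event below is covered by two events of this measure.
  obtain ⟨k, hk⟩ := (htend.eventually_lt_const (show (0 : ℝ≥0∞) < 1 / 2048 by simp)).exists
  simp only [Function.comp] at hk
  refine ⟨2 * k, fun S => ?_⟩
  push_cast
  refine lintegral_enorm_signSum_le_of_measure_le S y k ?_
  -- Adding the sum with all signs outside `S` flipped cancels the terms outside `S` and doubles
  -- those inside; then j → ∞ removes the weights.
  let s : ℕ+ → ℤˣ := fun n => if n ∈ S then 1 else -1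
  have hpt : ∀ ε, 2 * ‖signSum S y ε‖ₑ ≤ M ε + M (s * ε) := fun ε => by
    have hj : ∀ j, ‖(2 : ℝ) • signSum S (fun n => c j n • y n) ε‖ₑ ≤ M ε + M (s * ε) := fun j => by
      have : (2 : ℝ) • signSum S (fun n => c j n • y n) ε = V j ε + V j (s * ε) := by
        let g : ℕ+ → Y := fun n => ε n • c j n • y n + (s n * ε n) • c j n • y n
        have hT : V j ε + V j (s * ε) = ∑ n ∈ T j, g n := by
          simp only [V, signSum, ← Finset.sum_add_distrib]
          rfl
        rw [hT, signSum, Finset.smul_sum, Finset.sum_subset (Finset.subset_union_right (s₁ := S))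
          (f := g) fun n _ hn => by simp [g, hcT j n hn],
          ← Finset.sum_subset (Finset.subset_union_left (s₁ := S) (s₂ := T j))
          (f := g) fun n _ hn => by simp [g, s, hn]]
        refine Finset.sum_congr rfl fun n hn => ?_
        simp [g, s, hn, two_smul]
      rw [this]
      exact (enorm_add_le _ _).trans
        (add_le_add (le_iSup (fun j => ‖V j ε‖ₑ) j) (le_iSup (fun j => ‖V j (s * ε)‖ₑ) j))
    have hlim : Filter.Tendsto (fun j => ‖(2 : ℝ) • signSum S (fun n => c j n • y n) ε‖ₑ)
        Filter.atTop (nhds ‖(2 : ℝ) • signSum S y ε‖ₑ) := by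
      refine ((tendsto_finsetSum _ fun n _ => ?_).const_smul _).enorm
      simp_rw [smul_comm (ε n)]
      simpa using (hc n).smul_const (ε n • y n)
    have := le_of_tendsto' hlim hj
    rw [enorm_smul, Real.enorm_of_nonneg (by norm_num)] at this
    simpa using this
  have hsub : {ε | (k : ℝ≥0∞) < ‖signSum S y ε‖ₑ} ⊆
      {ε | (k : ℝ≥0∞) < M ε} ∪ (fun ε => s * ε) ⁻¹' {ε | (k : ℝ≥0∞) < M ε} := by
    intro ε hε
    by_contra hcon
    simp only [Set.mem_union, Set.mem_ofPred_eq, Set.mem_preimage, not_or, not_lt] at hcon hε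
    have h1 := (hpt ε).trans (add_le_add hcon.1 hcon.2)
    rw [← two_mul] at h1
    exact absurd ((ENNReal.mul_le_mul_iff_right (by simp) (by simp)).1 h1) (not_le.2 hε)
  refine (measure_mono hsub).trans ((measure_union_le _ _).trans ?_)
  rw [(measurePreserving_mul_signs s).measure_preimage (hset k).nullMeasurableSet]
  refine (add_le_add hk.le hk.le).trans (le_of_eq ?_)
  rw [← ENNReal.toReal_eq_toReal_iff' (by finiteness) (by finiteness)]
  rw [ENNReal.toReal_add (by finiteness) (by finiteness)]
  simp
  norm_num

end Boundedness

/-! ### Characters of the polytorus -/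

section Monomials

theorem torusMonomial_zero (w : ℕ → Circle) : torusMonomial 0 w = 1 := by
  simp [torusMonomial]

theorem torusMonomial_add (α β : ℕ →₀ ℤ) (w : ℕ → Circle) :
    torusMonomial (α + β) w = torusMonomial α w * torusMonomial β w :=
  Finsupp.prod_add_index' (fun _ => zpow_zero _) fun _ _ _ => zpow_add _ _ _

theorem torusMonomial_neg (α : ℕ →₀ ℤ) (w : ℕ → Circle) :
    torusMonomial (-α) w = (torusMonomial α w)⁻¹ :=
  eq_inv_of_mul_eq_one_left (by rw [← torusMonomial_add, neg_add_cancel, torusMonomial_zero])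

theorem torusMonomial_single (k : ℕ) (a : ℤ) (w : ℕ → Circle) :
    torusMonomial (Finsupp.single k a) w = w k ^ a := by
  simp [torusMonomial]

theorem torusMonomial_mul (α : ℕ →₀ ℤ) (v w : ℕ → Circle) :
    torusMonomial α (v * w) = torusMonomial α v * torusMonomial α w := by
  simp [torusMonomial, mul_zpow]

theorem continuous_torusMonomial (α : ℕ →₀ ℤ) : Continuous (torusMonomial α) := by
  unfold torusMonomial Finsupp.prod
  fun_prop

/-- The monomial `z^α` as a complex-valued function. -/
noncomputable def torusChar (α : ℕ →₀ ℤ) (w : ℕ → Circle) : ℂ := (torusMonomial α w : Circle)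

theorem torusChar_zero (w : ℕ → Circle) : torusChar 0 w = 1 := by
  rw [torusChar, torusMonomial_zero, Circle.coe_one]

theorem torusChar_add (α β : ℕ →₀ ℤ) (w : ℕ → Circle) :
    torusChar (α + β) w = torusChar α w * torusChar β w := by
  rw [torusChar, torusMonomial_add, Circle.coe_mul]; rfl

theorem torusChar_neg (α : ℕ →₀ ℤ) (w : ℕ → Circle) :
    torusChar (-α) w = starRingEnd ℂ (torusChar α w) := by
  rw [torusChar, torusMonomial_neg, Circle.coe_inv_eq_conj]; rfl

theorem torusChar_sub (α β : ℕ →₀ ℤ) (w : ℕ → Circle) :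
    torusChar (α - β) w = torusChar α w * starRingEnd ℂ (torusChar β w) := by
  rw [sub_eq_add_neg, torusChar_add, torusChar_neg]

theorem torusChar_single (k : ℕ) (a : ℤ) (w : ℕ → Circle) :
    torusChar (Finsupp.single k a) w = (w k : ℂ) ^ a := by
  rw [torusChar, torusMonomial_single, Circle.coe_zpow]

theorem torusChar_mul (α : ℕ →₀ ℤ) (v w : ℕ → Circle) :
    torusChar α (v * w) = torusChar α v * torusChar α w := by
  rw [torusChar, torusMonomial_mul, Circle.coe_mul]; rfl

@[simp]
theorem norm_torusChar (α : ℕ →₀ ℤ) (w : ℕ → Circle) : ‖torusChar α w‖ = 1 :=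
  Circle.norm_coe _

theorem continuous_torusChar (α : ℕ →₀ ℤ) : Continuous (torusChar α) :=
  continuous_subtype_val.comp (continuous_torusMonomial α)

theorem fourierCoefficient_eq {X : Type*} [NormedAddCommGroup X] [NormedSpace ℂ X]
    (f : (ℕ → Circle) → X) (α : ℕ →₀ ℤ) :
    fourierCoefficient f α = ∫ w, torusChar (-α) w • f w ∂polytorusHaar := rfl

end Monomials

/-! ### Haar measure and orthogonality of characters -/

section Haar

instance : circleHaar.IsMulLeftInvariant := by
  unfold circleHaar; infer_instance

instance : IsProbabilityMeasure polytorusHaar := by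
  unfold polytorusHaar; infer_instance

/-- The Haar measure of the polytorus is invariant under rotations. -/
theorem measurePreserving_rotation (u : ℕ → Circle) :
    MeasurePreserving (fun w : ℕ → Circle => u * w) polytorusHaar polytorusHaar := by
  refine ⟨(continuous_const.mul continuous_id).measurable, ?_⟩
  have := Measure.infinitePi_map_pi (fun _ : ℕ => circleHaar)
    (f := fun i v => u i * v) fun i => (continuous_const.mul continuous_id).measurable
  simp only [map_mul_left_eq_self] at this
  exact this

theorem integrable_torusChar (α : ℕ →₀ ℤ) :
    Integrable (torusChar α) polytorusHaar :=
  Integrable.of_bound (continuous_torusChar α).aestronglyMeasurable 1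
    (by simp)

theorem exists_circle_zpow_ne_one {a : ℤ} (ha : a ≠ 0) : ∃ u : Circle, u ^ a ≠ 1 := by
  refine ⟨Circle.exp (Real.pi / a), ?_⟩
  have h : a • (Real.pi / a) = Real.pi := by
    rw [zsmul_eq_mul]
    field_simp
  rw [← Circle.exp_zsmul, h]
  exact Circle.exp_pi_ne_one

/-- For α ≠ 0, a rotation in one coordinate multiplies the character by a constant other than 1 and
leaves the integral unchanged. -/
theorem integral_torusChar (α : ℕ →₀ ℤ) :
    ∫ w, torusChar α w ∂polytorusHaar = if α = 0 then 1 else 0 := by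
  split_ifs with h
  · simp [h, torusChar_zero]
  · obtain ⟨k, hk⟩ := Finsupp.ne_iff.1 h
    obtain ⟨u, hu⟩ := exists_circle_zpow_ne_one hk
    let v : ℕ → Circle := Pi.mulSingle k u
    have hv : torusMonomial α v = u ^ α k := by
      rw [torusMonomial, Finsupp.prod, Finset.prod_eq_single k]
      · simp [v]
      · intro i _ hi
        simp [v, hi]
      · intro hk'
        simp_all
    have := (measurePreserving_rotation v).integral_comp
      (Homeomorph.mulLeft v).measurableEmbedding fun w => torusChar α w
    simp only [torusChar_mul] at this
    rw [integral_const_mul] at this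
    have h1 : torusChar α v - 1 ≠ 0 := by
      rw [sub_ne_zero, torusChar, hv, Ne, Circle.coe_eq_one]
      exact hu
    refine (mul_eq_zero.1 ?_).resolve_left h1
    rw [sub_mul, this, one_mul, sub_self]

end Haar

/-! ### Monomials and Fourier coefficients in L_q -/

section Lp

variable {X : Type*} [NormedAddCommGroup X] [NormedSpace ℂ X] {q : ℝ≥0∞} [hq : Fact (1 ≤ q)]

theorem memLp_monomial_smul (q : ℝ≥0∞) (α : ℕ →₀ ℤ) (x : X) :
    MemLp (fun w => torusChar α w • x) q polytorusHaar :=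
  MemLp.of_bound ((continuous_torusChar α).smul continuous_const).aestronglyMeasurable
    ‖x‖ (by simp [norm_smul])

variable (X q) in
/-- The embedding `x ↦ z^α x` of `X` into `L_q(𝕋^ℕ, X)`. -/
noncomputable def monomialLp (α : ℕ →₀ ℤ) : X →ₗᵢ[ℂ] Lp X q polytorusHaar where
  toFun x := (memLp_monomial_smul q α x).toLp _
  map_add' x y := by
    rw [← MemLp.toLp_add]
    congr 1
    ext w
    simp
  map_smul' c x := by
    rw [RingHom.id_apply, ← MemLp.toLp_const_smul]
    congr 1
    ext w
    simp [smul_comm c]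
  norm_map' x := by
    have : q ≠ 0 := (zero_lt_one.trans_le hq.out).ne'
    simp only [LinearMap.coe_mk, AddHom.coe_mk, Lp.norm_toLp]
    rw [eLpNorm_congr_norm_ae (g := fun _ => x) (by simp [norm_smul]),
      eLpNorm_const _ this (NeZero.ne _)]
    simp

theorem coeFn_monomialLp (α : ℕ →₀ ℤ) (x : X) :
    monomialLp X q α x =ᵐ[polytorusHaar] fun w => torusChar α w • x :=
  MemLp.coeFn_toLp (memLp_monomial_smul q α x)

theorem coeFn_sum_monomialLp {ι : Type*} (s : Finset ι) (a : ι → ℕ →₀ ℤ) (x : ι → X) :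
    (∑ i ∈ s, monomialLp X q (a i) (x i) : Lp X q polytorusHaar) =ᵐ[polytorusHaar]
      fun w => ∑ i ∈ s, torusChar (a i) w • x i := by
  classical
  induction s using Finset.induction_on with
  | empty => simpa [Pi.zero_def] using Lp.coeFn_zero X q polytorusHaar
  | insert i s hi ih =>
    rw [Finset.sum_insert hi]
    filter_upwards [Lp.coeFn_add (monomialLp X q (a i) (x i)) (∑ i ∈ s, monomialLp X q (a i) (x i)),
      ih, coeFn_monomialLp (q := q) (a i) (x i)] with w h1 h2 h3
    rw [h1, Pi.add_apply, h2, h3, Finset.sum_insert hi]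

theorem integrable_monomial_smul {f : (ℕ → Circle) → X} (hf : Integrable f polytorusHaar)
    (α : ℕ →₀ ℤ) : Integrable (fun w => torusChar α w • f w) polytorusHaar :=
  hf.bdd_smul (φ := fun w => torusChar α w) 1
    (continuous_torusChar α).aestronglyMeasurable (by simp)

theorem fourierCoefficient_congr {f g : (ℕ → Circle) → X} (h : f =ᵐ[polytorusHaar] g)
    (α : ℕ →₀ ℤ) : fourierCoefficient f α = fourierCoefficient g α :=
  integral_congr_ae (by filter_upwards [h] with w hw; rw [hw])

variable (X q) in
/-- The Fourier coefficient at `α`, as a continuous linear map on `L_q(𝕋^ℕ, X)`. -/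
noncomputable def fourierLp (α : ℕ →₀ ℤ) : Lp X q polytorusHaar →L[ℂ] X :=
  LinearMap.mkContinuous
    { toFun := fun f => fourierCoefficient f α
      map_add' := fun f g => by
        rw [fourierCoefficient_congr (Lp.coeFn_add f g)]
        simp only [fourierCoefficient_eq, Pi.add_apply, smul_add]
        exact integral_add (integrable_monomial_smul ((Lp.memLp f).integrable hq.out) _)
          (integrable_monomial_smul ((Lp.memLp g).integrable hq.out) _)
      map_smul' := fun c f => by
        rw [fourierCoefficient_congr (Lp.coeFn_smul c f)]
        simp only [fourierCoefficient_eq, Pi.smul_apply, smul_comm _ c, RingHom.id_apply]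
        exact integral_smul c _ }
    1 fun f => by
      rw [one_mul]
      refine (norm_integral_le_integral_norm _).trans ?_
      simp only [norm_smul, Circle.norm_coe, one_mul]
      rw [integral_norm_eq_lintegral_enorm (Lp.aestronglyMeasurable f), ← eLpNorm_one_eq_lintegral_enorm,
        Lp.norm_def]
      exact ENNReal.toReal_mono (Lp.eLpNorm_ne_top f)
        (eLpNorm_le_eLpNorm_of_exponent_le hq.out (Lp.aestronglyMeasurable f))

theorem fourierLp_apply (α : ℕ →₀ ℤ) (f : Lp X q polytorusHaar) :
    fourierLp X q α f = fourierCoefficient f α := rfl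

theorem fourierLp_toLp (α : ℕ →₀ ℤ) {f : (ℕ → Circle) → X} (hf : MemLp f q polytorusHaar) :
    fourierLp X q α (hf.toLp f) = fourierCoefficient f α :=
  fourierCoefficient_congr hf.coeFn_toLp α

theorem fourierLp_monomialLp [CompleteSpace X] (α β : ℕ →₀ ℤ) (x : X) :
    fourierLp X q α (monomialLp X q β x) = if β = α then x else 0 := by
  rw [fourierLp_apply, fourierCoefficient_congr (coeFn_monomialLp β x), fourierCoefficient_eq]
  simp only [smul_smul, ← torusChar_add]
  rw [integral_smul_const, integral_torusChar, ite_smul, one_smul, zero_smul]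
  simp [neg_add_eq_zero, eq_comm (a := α)]

end Lp

/-! ### Density of trigonometric polynomials -/

section Density

/-- The star algebra of trigonometric polynomials on `𝕋^ℕ`. -/
noncomputable def trigSubalgebra : StarSubalgebra ℂ C(ℕ → Circle, ℂ) where
  toSubalgebra := Algebra.adjoin ℂ (Set.range fun α => ⟨torusChar α, continuous_torusChar α⟩)
  star_mem' := by
    change Algebra.adjoin ℂ _ ≤ star (Algebra.adjoin ℂ _)
    refine Algebra.adjoin_le ?_
    rintro _ ⟨α, rfl⟩
    refine Algebra.subset_adjoin ⟨-α, ?_⟩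
    ext w
    exact torusChar_neg α w

/-- The characters are closed under multiplication and contain 1. -/
theorem trigSubalgebra_coe : trigSubalgebra.toSubalgebra.toSubmodule =
    Submodule.span ℂ (Set.range fun α => (⟨torusChar α, continuous_torusChar α⟩ : C(_, ℂ))) := by
  apply Algebra.adjoin_eq_span_of_subset
  refine .trans (fun x => Submonoid.closure_induction (fun _ => id) ⟨0, ?_⟩ ?_)
    Submodule.subset_span
  · ext w
    exact torusChar_zero w
  · rintro _ _ _ _ ⟨α, rfl⟩ ⟨β, rfl⟩
    exact ⟨α + β, by ext w; exact torusChar_add α β w⟩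

theorem trigSubalgebra_separatesPoints : trigSubalgebra.SeparatesPoints := by
  intro v w hvw
  obtain ⟨k, hk⟩ := Function.ne_iff.1 hvw
  refine ⟨_, ⟨_, Algebra.subset_adjoin ⟨Finsupp.single k 1, rfl⟩, rfl⟩, ?_⟩
  simp only [ContinuousMap.coe_mk, torusChar_single, zpow_one]
  exact fun h => hk (Circle.ext h)

theorem exists_trigPolynomial_norm_sub_lt (f : C(ℕ → Circle, ℂ)) {δ : ℝ} (hδ : 0 < δ) :
    ∃ g ∈ Submodule.span ℂ
      (Set.range fun α => (⟨torusChar α, continuous_torusChar α⟩ : C(_, ℂ))), ‖f - g‖ < δ := by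
  have h := ContinuousMap.starSubalgebra_topologicalClosure_eq_top_of_separatesPoints
    trigSubalgebra trigSubalgebra_separatesPoints
  have hf : f ∈ closure (trigSubalgebra : Set C(ℕ → Circle, ℂ)) := by
    rw [← StarSubalgebra.topologicalClosure_coe, h]
    trivial
  obtain ⟨g, hg, hfg⟩ := Metric.mem_closure_iff.1 hf δ hδ
  refine ⟨g, ?_, by rwa [dist_eq_norm] at hfg⟩
  rw [← trigSubalgebra_coe]
  exact hg

variable {X : Type*} [NormedAddCommGroup X] [NormedSpace ℂ X] {q : ℝ≥0∞} [hq : Fact (1 ≤ q)]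

variable (X q) in
/-- The `X`-valued trigonometric polynomials in `L_q(𝕋^ℕ, X)`. -/
noncomputable def trigSpan : Submodule ℂ (Lp X q polytorusHaar) :=
  Submodule.span ℂ (⋃ α, Set.range (monomialLp X q α))

theorem monomialLp_mem_trigSpan (α : ℕ →₀ ℤ) (x : X) : monomialLp X q α x ∈ trigSpan X q :=
  Submodule.subset_span (Set.mem_iUnion.2 ⟨α, x, rfl⟩)

theorem exists_mem_trigSpan_ae_eq_smul_const {g : C(ℕ → Circle, ℂ)}
    (hg : g ∈ Submodule.span ℂ
      (Set.range fun α => (⟨torusChar α, continuous_torusChar α⟩ : C(_, ℂ)))) (x : X) :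
    ∃ G ∈ trigSpan X q, (fun w => g w • x) =ᵐ[polytorusHaar] G := by
  induction hg using Submodule.span_induction with
  | mem g hg =>
    obtain ⟨α, rfl⟩ := hg
    exact ⟨_, monomialLp_mem_trigSpan α x, (coeFn_monomialLp α x).symm⟩
  | zero => exact ⟨0, zero_mem _, by simpa [Pi.zero_def] using (Lp.coeFn_zero X q _).symm⟩
  | add g h _ _ ihg ihh =>
    obtain ⟨G, hG, eG⟩ := ihg
    obtain ⟨H, hH, eH⟩ := ihh
    refine ⟨G + H, add_mem hG hH, ?_⟩
    filter_upwards [eG, eH, Lp.coeFn_add G H] with w h1 h2 h3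
    rw [h3, Pi.add_apply, ← h1, ← h2, ContinuousMap.add_apply, add_smul]
  | smul c g _ ihg =>
    obtain ⟨G, hG, eG⟩ := ihg
    refine ⟨c • G, Submodule.smul_mem _ _ hG, ?_⟩
    filter_upwards [eG, Lp.coeFn_smul c G] with w h1 h2
    rw [h2, Pi.smul_apply, ← h1, ContinuousMap.smul_apply, smul_assoc]

/-- The trigonometric polynomials are dense in `L_q(𝕋^ℕ, X)`. -/
theorem exists_mem_trigSpan_norm_sub_le (hq' : q ≠ ∞) (f : Lp X q polytorusHaar) {δ : ℝ}
    (hδ : 0 < δ) : ∃ G ∈ trigSpan X q, ‖f - G‖ ≤ δ := by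
  suffices H : ∃ g : (ℕ → Circle) → X, eLpNorm (⇑f - g) q polytorusHaar ≤ ENNReal.ofReal δ ∧
      ∃ G ∈ trigSpan X q, g =ᵐ[polytorusHaar] G by
    obtain ⟨g, hg, G, hG, e⟩ := H
    refine ⟨G, hG, ?_⟩
    rw [Lp.norm_def]
    refine ENNReal.toReal_le_of_le_ofReal hδ.le (le_trans (le_of_eq (eLpNorm_congr_ae ?_)) hg)
    filter_upwards [e, Lp.coeFn_sub f G] with w h1 h2
    rw [h2, Pi.sub_apply, Pi.sub_apply, h1]
  refine MemLp.induction_dense hq' _ ?_ ?_ ?_ (Lp.memLp f)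
    (ENNReal.ofReal_pos.2 hδ).ne'
  · intro x s hs _ ε hε
    -- Two errors of size η: the scalar indicator is approximated in L_q by a continuous function,
    -- and that one uniformly by a trigonometric polynomial. The summand 1 in the denominator covers
    -- x = 0.
    obtain ⟨η, hη, hηε⟩ : ∃ η : ℝ≥0∞, η ≠ 0 ∧ ‖x‖ₑ * (η + η) ≤ ε := by
      refine ⟨ε / (2 * (‖x‖ₑ + 1)), (ENNReal.div_pos hε (by finiteness)).ne', ?_⟩
      calc ‖x‖ₑ * (ε / (2 * (‖x‖ₑ + 1)) + ε / (2 * (‖x‖ₑ + 1)))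
          ≤ (‖x‖ₑ + 1) * (ε / (2 * (‖x‖ₑ + 1)) + ε / (2 * (‖x‖ₑ + 1))) := by
            gcongr
            exact le_self_add
        _ = 2 * (‖x‖ₑ + 1) * (ε / (2 * (‖x‖ₑ + 1))) := by ring
        _ ≤ ε := ENNReal.mul_div_le
    have hmem : MemLp (s.indicator fun _ => (1 : ℂ)) q polytorusHaar :=
      memLp_indicator_const _ hs _ (Or.inr (measure_ne_top _ _))
    obtain ⟨h, hh, -⟩ := hmem.exists_boundedContinuous_eLpNorm_sub_le hq' hη
    obtain ⟨r, hr, hrη⟩ : ∃ r : ℝ, 0 < r ∧ ENNReal.ofReal r ≤ η := by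
      rcases eq_or_ne η ∞ with rfl | hη'
      · exact ⟨1, one_pos, le_top⟩
      · exact ⟨η.toReal, ENNReal.toReal_pos hη hη', ENNReal.ofReal_toReal_le⟩
    obtain ⟨t, ht, hht⟩ := exists_trigPolynomial_norm_sub_lt h.toContinuousMap hr
    refine ⟨fun w => t w • x, ?_, exists_mem_trigSpan_ae_eq_smul_const ht x⟩
    have h2 : eLpNorm (fun w => h w - t w) q polytorusHaar ≤ η := by
      refine (eLpNorm_le_of_ae_bound (C := r) (ae_of_all _ fun w => ?_)).trans ?_
      · exact ((h.toContinuousMap - t).norm_coe_le_norm w).trans hht.le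
      · simpa using hrη
    have h3 : eLpNorm (fun w => t w - s.indicator (fun _ => (1 : ℂ)) w) q polytorusHaar ≤
        η + η := by
      have e : (fun w => t w - s.indicator (fun _ => (1 : ℂ)) w) =
          (fun w => -(h w - t w)) + fun w => -((s.indicator (fun _ => (1 : ℂ)) - h) w) := by
        ext w
        simp
      rw [e]
      have hm1 : AEStronglyMeasurable (fun w => -(h w - t w)) polytorusHaar :=
        (h.continuous.sub t.continuous).neg.aestronglyMeasurable
      have hm2 : AEStronglyMeasurable
          (fun w => -((s.indicator (fun _ => (1 : ℂ)) - (h : _ → ℂ)) w)) polytorusHaar :=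
        (hmem.aestronglyMeasurable.sub h.continuous.aestronglyMeasurable).neg
      refine (eLpNorm_add_le hm1 hm2 hq.out).trans (add_le_add ?_ ?_)
      · exact (eLpNorm_neg (fun w => h w - t w) q polytorusHaar).trans_le h2
      · exact (eLpNorm_neg (s.indicator (fun _ => (1 : ℂ)) - (h : _ → ℂ)) q polytorusHaar).trans_le hh
    refine le_trans ?_ hηε
    have e : ((fun w => t w • x) - s.indicator fun _ => x) =
        fun w => (t w - s.indicator (fun _ => (1 : ℂ)) w) • x := by
      ext w
      by_cases hw : w ∈ s <;> simp [hw, sub_smul]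
    rw [e]
    refine (eLpNorm_le_nnreal_smul_eLpNorm_of_ae_le_mul (c := ‖x‖₊)
      (g := fun w => t w - s.indicator (fun _ => (1 : ℂ)) w) (ae_of_all _ fun w => ?_) q).trans ?_
    · rw [nnnorm_smul, mul_comm]
    · rw [ENNReal.smul_def, smul_eq_mul]
      exact mul_le_mul_right h3 _
  · rintro g h ⟨G, hG, eG⟩ ⟨H, hH, eH⟩
    exact ⟨G + H, add_mem hG hH, (eG.add eH).trans (Lp.coeFn_add G H).symm⟩
  · rintro g ⟨G, -, eG⟩
    exact (Lp.aestronglyMeasurable G).congr eG.symm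

end Density

/-! ### A Schur test -/

section Kernel

/-- The Schur test for Markov kernels. -/
theorem lintegral_rpow_lintegral_mul_le {Ω : Type*} [MeasurableSpace Ω] {μ : Measure Ω}
    [SFinite μ] {K : Ω → Ω → ℝ≥0∞} (hK : Measurable (Function.uncurry K))
    (h1 : ∀ w, ∫⁻ u, K w u ∂μ = 1) (h2 : ∀ u, ∫⁻ w, K w u ∂μ = 1) {g : Ω → ℝ≥0∞}
    (hg : Measurable g) {p : ℝ} (hp : 1 ≤ p) :
    ∫⁻ w, (∫⁻ u, K w u * g u ∂μ) ^ p ∂μ ≤ ∫⁻ u, g u ^ p ∂μ := by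
  have hp0 : 0 < p := by linarith
  -- Jensen's inequality for the probability density K(w, ·), from Hölder with exponents 1/p and 1 -
  -- 1/p.
  have hpt : ∀ w, (∫⁻ u, K w u * g u ∂μ) ^ p ≤ ∫⁻ u, K w u * g u ^ p ∂μ := fun w => by
    have hKw : Measurable (K w) := hK.of_uncurry_left
    have h := ENNReal.lintegral_mul_norm_pow_le (μ := μ) (hKw.mul (hg.pow_const p)).aemeasurable
      hKw.aemeasurable (p := 1 / p) (q := 1 - 1 / p) (by positivity)
      (by rw [sub_nonneg, div_le_one hp0]; exact hp) (by ring)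
    rw [h1, ENNReal.one_rpow, mul_one] at h
    have e : ∀ u, (K w u * g u ^ p) ^ (1 / p) * K w u ^ (1 - 1 / p) = K w u * g u := fun u => by
      rw [ENNReal.mul_rpow_of_nonneg _ _ (by positivity), ← ENNReal.rpow_mul, mul_one_div_cancel
        hp0.ne', ENNReal.rpow_one, mul_right_comm, ← ENNReal.rpow_add_of_nonneg _ _ (by positivity)
        (by rw [sub_nonneg, div_le_one hp0]; exact hp), add_sub_cancel, ENNReal.rpow_one]
    simp only [Pi.mul_apply, e] at h
    calc (∫⁻ u, K w u * g u ∂μ) ^ p ≤ ((∫⁻ u, K w u * g u ^ p ∂μ) ^ (1 / p)) ^ p := by gcongr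
      _ = _ := by rw [← ENNReal.rpow_mul, one_div_mul_cancel hp0.ne', ENNReal.rpow_one]
  refine (lintegral_mono hpt).trans (le_of_eq ?_)
  have hm : Measurable (Function.uncurry fun w u => K w u * g u ^ p) :=
    hK.mul ((hg.pow_const p).comp measurable_snd)
  rw [lintegral_lintegral_swap hm.aemeasurable]
  refine lintegral_congr fun u => ?_
  rw [lintegral_mul_const _ hK.of_uncurry_right, h2, one_mul]

end Kernel

/-! ### Fejér means on the infinite polytorus -/

section Fejer

open Finset in
/-- The Fourier coefficients of the kernel `|A|⁻¹ |∑_{α ∈ A} z^α|²`. -/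
noncomputable def fejerCoeff (A : Finset (ℕ →₀ ℤ)) (γ : ℕ →₀ ℤ) : ℝ :=
  #{i ∈ A ×ˢ A | i.1 - i.2 = γ} / #A

variable {X : Type*} [NormedAddCommGroup X] [NormedSpace ℂ X] {q : ℝ≥0∞} [hq : Fact (1 ≤ q)]

/-- Convolution with the kernel `|A|⁻¹ |∑_{α ∈ A} z^α|²`. -/
noncomputable def fejer (A : Finset (ℕ →₀ ℤ)) (f : Lp X q polytorusHaar) :
    Lp X q polytorusHaar :=
  ∑ i ∈ A ×ˢ A, monomialLp X q (i.1 - i.2) ((A.card : ℂ)⁻¹ • fourierLp X q (i.1 - i.2) f)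

theorem fejer_sub (A : Finset (ℕ →₀ ℤ)) (f g : Lp X q polytorusHaar) :
    fejer A (f - g) = fejer A f - fejer A g := by
  simp only [fejer, ← Finset.sum_sub_distrib, ← map_sub, ← smul_sub]

theorem fejer_add (A : Finset (ℕ →₀ ℤ)) (f g : Lp X q polytorusHaar) :
    fejer A (f + g) = fejer A f + fejer A g := by
  simp only [fejer, ← Finset.sum_add_distrib, ← map_add, ← smul_add]

theorem fejer_smul (A : Finset (ℕ →₀ ℤ)) (c : ℂ) (f : Lp X q polytorusHaar) :
    fejer A (c • f) = c • fejer A f := by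
  simp only [fejer, Finset.smul_sum, ← map_smul, smul_comm c]

theorem fejer_eq (A : Finset (ℕ →₀ ℤ)) (f : Lp X q polytorusHaar) :
    fejer A f = ∑ γ ∈ (A ×ˢ A).image fun i => i.1 - i.2,
      (fejerCoeff A γ : ℂ) • monomialLp X q γ (fourierLp X q γ f) := by
  rw [fejer, Finset.sum_comp (fun γ => monomialLp X q γ ((A.card : ℂ)⁻¹ • fourierLp X q γ f))
    fun i : (ℕ →₀ ℤ) × (ℕ →₀ ℤ) => i.1 - i.2]
  refine Finset.sum_congr rfl fun γ _ => ?_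
  rw [map_smul, ← Nat.cast_smul_eq_nsmul ℂ, smul_smul, fejerCoeff]
  push_cast
  rw [div_eq_mul_inv]

theorem fejerCoeff_eq_zero {A : Finset (ℕ →₀ ℤ)} {γ : ℕ →₀ ℤ}
    (h : γ ∉ (A ×ˢ A).image fun i => i.1 - i.2) : fejerCoeff A γ = 0 := by
  rw [fejerCoeff, Finset.filter_false_of_mem]
  · simp
  · intro i hi hγ
    exact h (Finset.mem_image.2 ⟨i, hi, hγ⟩)

theorem fejer_monomialLp [CompleteSpace X] (A : Finset (ℕ →₀ ℤ)) (γ : ℕ →₀ ℤ) (x : X) :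
    fejer A (monomialLp X q γ x) = (fejerCoeff A γ : ℂ) • monomialLp X q γ x := by
  rw [fejer_eq]
  simp only [fourierLp_monomialLp]
  by_cases h : γ ∈ (A ×ˢ A).image fun i => i.1 - i.2
  · rw [Finset.sum_eq_single_of_mem γ h fun β _ hβ => by simp [hβ.symm]]
    simp
  · rw [fejerCoeff_eq_zero h, Complex.ofReal_zero, zero_smul]
    refine Finset.sum_eq_zero fun β hβ => ?_
    have : γ ≠ β := fun e => h (e ▸ hβ)
    simp [this]

/-- The kernel `|A|⁻¹ |∑_{α ∈ A} (w u⁻¹)^α|²`. -/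
noncomputable def fejerKernel (A : Finset (ℕ →₀ ℤ)) (w u : ℕ → Circle) : ℝ :=
  (A.card : ℝ)⁻¹ * ‖∑ α ∈ A, torusChar α w * starRingEnd ℂ (torusChar α u)‖ ^ 2

theorem fejerKernel_nonneg (A : Finset (ℕ →₀ ℤ)) (w u : ℕ → Circle) : 0 ≤ fejerKernel A w u := by
  unfold fejerKernel; positivity

theorem fejerKernel_comm (A : Finset (ℕ →₀ ℤ)) (w u : ℕ → Circle) :
    fejerKernel A w u = fejerKernel A u w := by
  rw [fejerKernel, ← RCLike.norm_conj, map_sum]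
  simp [fejerKernel, mul_comm]

theorem continuous_fejerKernel (A : Finset (ℕ →₀ ℤ)) :
    Continuous (Function.uncurry (fejerKernel A)) := by
  unfold fejerKernel Function.uncurry
  have h := fun α => continuous_torusChar α
  fun_prop

theorem coe_fejerKernel (A : Finset (ℕ →₀ ℤ)) (w u : ℕ → Circle) :
    (fejerKernel A w u : ℂ) = ∑ i ∈ A ×ˢ A,
      (A.card : ℂ)⁻¹ * torusChar (i.1 - i.2) w * torusChar (-(i.1 - i.2)) u := by
  rw [fejerKernel]
  push_cast
  rw [← Complex.mul_conj', map_sum, Finset.sum_mul_sum, ← Finset.sum_product', Finset.mul_sum]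
  refine Finset.sum_congr rfl fun i _ => ?_
  rw [torusChar_neg, torusChar_sub, torusChar_sub]
  simp only [map_mul, Complex.conj_conj]
  ring

theorem integral_fejerKernel {A : Finset (ℕ →₀ ℤ)} (hA : A.Nonempty) (w : ℕ → Circle) :
    ∫ u, fejerKernel A w u ∂polytorusHaar = 1 := by
  have hc : (A.card : ℂ) ≠ 0 := by simpa using hA.ne_empty
  rw [← Complex.ofReal_inj, ← integral_complex_ofReal]
  simp only [coe_fejerKernel]
  rw [integral_finsetSum _ fun i _ => (integrable_torusChar _).const_mul _]
  simp only [integral_const_mul, integral_torusChar, neg_eq_zero, sub_eq_zero]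
  rw [Finset.sum_product]
  have : ∀ α ∈ A, ∑ β ∈ A, (A.card : ℂ)⁻¹ * torusChar (α - β) w * (if α = β then 1 else 0) =
      (A.card : ℂ)⁻¹ := fun α hα => by
    rw [Finset.sum_eq_single_of_mem α hα fun β _ hβ => by simp [hβ.symm]]
    simp [torusChar_zero]
  rw [Finset.sum_congr rfl this]
  simp [hc]

theorem lintegral_fejerKernel {A : Finset (ℕ →₀ ℤ)} (hA : A.Nonempty) (w : ℕ → Circle) :
    ∫⁻ u, ENNReal.ofReal (fejerKernel A w u) ∂polytorusHaar = 1 := by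
  have hint : Integrable (fejerKernel A w) polytorusHaar := by
    by_contra h
    have := integral_fejerKernel hA w
    rw [integral_undef h] at this
    exact zero_ne_one this
  rw [← ofReal_integral_eq_lintegral_ofReal hint (ae_of_all _ (fejerKernel_nonneg A w)),
    integral_fejerKernel hA, ENNReal.ofReal_one]

/-- Expanding the squared modulus in the kernel recovers the finite Fourier sum; the integral form
makes positivity available. -/
theorem coeFn_fejer (A : Finset (ℕ →₀ ℤ)) (f : Lp X q polytorusHaar) :
    fejer A f =ᵐ[polytorusHaar]
      fun w => ∫ u, (fejerKernel A w u : ℂ) • f u ∂polytorusHaar := by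
  refine (coeFn_sum_monomialLp _ _ _).trans (ae_of_all _ fun w => ?_)
  have hint : Integrable f polytorusHaar := (Lp.memLp f).integrable hq.out
  simp only [coe_fejerKernel, Finset.sum_smul, fourierLp_apply, fourierCoefficient_eq, mul_smul]
  have hi : ∀ i ∈ A ×ˢ A, Integrable (fun u => (A.card : ℂ)⁻¹ • torusChar (i.1 - i.2) w •
      torusChar (-(i.1 - i.2)) u • f u) polytorusHaar := fun i _ =>
    ((integrable_monomial_smul hint _).smul _).smul _
  rw [integral_finsetSum _ hi]
  refine Finset.sum_congr rfl fun i _ => ?_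
  rw [integral_smul, integral_smul, smul_comm]

/-- The kernel is non-negative, symmetric and of total mass 1 in each variable, so the Schur test
applies to the norm of `f`. -/
theorem norm_fejer_le (hq' : q ≠ ∞) {A : Finset (ℕ →₀ ℤ)} (hA : A.Nonempty)
    (f : Lp X q polytorusHaar) : ‖fejer A f‖ ≤ ‖f‖ := by
  have hq0 : q ≠ 0 := (zero_lt_one.trans_le hq.out).ne'
  rw [Lp.norm_def, Lp.norm_def]
  refine ENNReal.toReal_mono (Lp.eLpNorm_ne_top f) ?_
  rw [eLpNorm_congr_ae (coeFn_fejer A f), eLpNorm_eq_lintegral_rpow_enorm_toReal hq0 hq',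
    eLpNorm_eq_lintegral_rpow_enorm_toReal hq0 hq']
  refine ENNReal.rpow_le_rpow (le_trans (lintegral_mono fun w => ?_)
    (lintegral_rpow_lintegral_mul_le (K := fun w u => ENNReal.ofReal (fejerKernel A w u))
      (continuous_fejerKernel A).measurable.ennreal_ofReal (lintegral_fejerKernel hA)
      (fun u => ?_) (Lp.stronglyMeasurable f).enorm ?_)) (by positivity)
  · refine ENNReal.rpow_le_rpow ((enorm_integral_le_lintegral_enorm _).trans (le_of_eq ?_))
      ENNReal.toReal_nonneg
    refine lintegral_congr fun u => ?_
    rw [enorm_smul, ← ofReal_norm, Complex.norm_real,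
      Real.norm_of_nonneg (fejerKernel_nonneg A w u)]
  · simp only [fejerKernel_comm A _ u]
    exact lintegral_fejerKernel hA u
  · exact (ENNReal.dichotomy q).resolve_left hq'

/-- The discrete cube `{0, …, N-1}^N`. -/
noncomputable def cube (N : ℕ) : Finset (ℕ →₀ ℤ) :=
  Finset.finsupp (Finset.range N) fun _ => Finset.Ico 0 (N : ℤ)

theorem card_cube (N : ℕ) : (cube N).card = N ^ N := by
  simp [cube, Finset.card_finsupp]

theorem cube_nonempty (N : ℕ) : (cube N).Nonempty := by
  rw [← Finset.card_pos, card_cube]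
  rcases Nat.eq_zero_or_pos N with rfl | h
  · simp
  · exact pow_pos h _

theorem fejerCoeff_le_one (A : Finset (ℕ →₀ ℤ)) (γ : ℕ →₀ ℤ) : fejerCoeff A γ ≤ 1 := by
  refine div_le_one_of_le₀ ?_ (Nat.cast_nonneg _)
  refine Nat.cast_le.2 (Finset.card_le_card_of_injOn Prod.fst ?_ ?_)
  · intro i hi
    simp only [Finset.coe_filter, Finset.mem_product, Set.mem_ofPred_eq] at hi
    exact hi.1.1
  · rintro ⟨a, b⟩ hi ⟨c, d⟩ hj (h : a = c)
    simp only [Finset.coe_filter, Finset.mem_product, Set.mem_ofPred_eq] at hi hj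
    have := hi.2.trans hj.2.symm
    subst h
    simpa using this

theorem prod_le_fejerCoeff_cube {N : ℕ} {γ : ℕ →₀ ℤ} (hN : 0 < N)
    (hsupp : γ.support ⊆ Finset.range N) (hγ : ∀ i, |γ i| ≤ N) :
    ∏ i ∈ γ.support, (1 - |(γ i : ℝ)| / N) ≤ fejerCoeff (cube N) γ := by
  have hN' : (0 : ℝ) < N := by exact_mod_cast hN
  -- The admissible values of β i for which both β i and β i + γ i lie in {0, …, N-1}; there are at
  -- least N - |γ i| of them.
  let t : ℕ → Finset ℤ := fun i => Finset.Ico (max 0 (-γ i)) (min (N : ℤ) (N - γ i))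
  have h1 : ((Finset.range N).finsupp t).card ≤
      (Finset.filter (fun i : (ℕ →₀ ℤ) × (ℕ →₀ ℤ) => i.1 - i.2 = γ) (cube N ×ˢ cube N)).card := by
    refine Finset.card_le_card_of_injOn (fun β => (β + γ, β)) ?_ ?_
    · intro β hβ
      obtain ⟨hβs, hβt⟩ := Finset.mem_finsupp_iff.1 (Finset.mem_coe.1 hβ)
      simp only [Finset.coe_filter, Finset.mem_product, Set.mem_ofPred_eq, cube,
        Finset.mem_finsupp_iff]
      refine ⟨⟨⟨Finsupp.support_add.trans (Finset.union_subset hβs hsupp), fun i hi => ?_⟩,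
        hβs, fun i hi => ?_⟩, by simp⟩ <;>
      · have := hβt i hi
        simp only [t, Finset.mem_Ico] at this
        simp only [Finset.mem_Ico, Finsupp.add_apply]
        omega
    · intro β _ β' _ h
      exact (Prod.ext_iff.1 h).2
  have h2 : ∀ i, (N : ℝ) - |(γ i : ℝ)| ≤ (t i).card := fun i => by
    have : (N : ℤ) - |γ i| ≤ (t i).card := by
      simp only [t, Int.card_Ico]
      rcases abs_cases (γ i) with h | h <;> omega
    exact_mod_cast this
  rw [fejerCoeff, le_div_iff₀ (by rw [card_cube]; positivity)]
  calc (∏ i ∈ γ.support, (1 - |(γ i : ℝ)| / N)) * ((cube N).card : ℝ)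
      = (∏ i ∈ Finset.range N, (1 - |(γ i : ℝ)| / N)) * ∏ i ∈ Finset.range N, (N : ℝ) := by
        rw [card_cube, Finset.prod_subset hsupp fun i _ hi => by
          simp [Finsupp.notMem_support_iff.1 hi]]
        simp
    _ = ∏ i ∈ Finset.range N, ((N : ℝ) - |(γ i : ℝ)|) := by
        rw [← Finset.prod_mul_distrib]
        refine Finset.prod_congr rfl fun i _ => ?_
        field_simp
    _ ≤ ∏ i ∈ Finset.range N, ((t i).card : ℝ) := by
        refine Finset.prod_le_prod (fun i _ => ?_) fun i _ => h2 i
        have : (|γ i| : ℝ) ≤ N := by exact_mod_cast hγ i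
        linarith
    _ ≤ _ := by
        rw [← Nat.cast_prod, ← Finset.card_finsupp]
        exact_mod_cast h1

/-- The lower bound is a product over the fixed finite support of γ, each factor tending to 1,
although the dimension of the cube grows with N. -/
theorem tendsto_fejerCoeff_cube (γ : ℕ →₀ ℤ) :
    Filter.Tendsto (fun N => fejerCoeff (cube N) γ) Filter.atTop (nhds 1) := by
  have hlow : Filter.Tendsto (fun N : ℕ => ∏ i ∈ γ.support, (1 - |(γ i : ℝ)| / N)) Filter.atTop
      (nhds 1) := by
    have : ∀ i ∈ γ.support, Filter.Tendsto (fun N : ℕ => 1 - |(γ i : ℝ)| / N) Filter.atTop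
        (nhds 1) := fun i _ => by
      simpa using (tendsto_const_div_atTop_nhds_zero_nat |(γ i : ℝ)|).const_sub 1
    simpa using tendsto_finsetProd _ this
  refine tendsto_of_tendsto_of_tendsto_of_le_of_le' hlow tendsto_const_nhds ?_
    (Filter.Eventually.of_forall fun N => fejerCoeff_le_one _ _)
  obtain ⟨M, hM⟩ := γ.support.bddAbove
  filter_upwards [Filter.eventually_gt_atTop M,
    Filter.eventually_ge_atTop (∑ i ∈ γ.support, |γ i|).toNat] with N h1 h2
  refine prod_le_fejerCoeff_cube (by omega) (fun i hi => ?_) fun i => ?_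
  · exact Finset.mem_range.2 ((hM hi).trans_lt h1)
  · by_cases hi : i ∈ γ.support
    · have := Finset.single_le_sum (fun j _ => abs_nonneg (γ j)) hi
      omega
    · simp [Finsupp.notMem_support_iff.1 hi]

/-- Fejér's theorem in `L_q(𝕋^ℕ, X)`. -/
theorem tendsto_fejer [CompleteSpace X] (hq' : q ≠ ∞) (f : Lp X q polytorusHaar) :
    Filter.Tendsto (fun N => fejer (cube N) f) Filter.atTop (nhds f) := by
  have hspan : ∀ G ∈ trigSpan X q,
      Filter.Tendsto (fun N => fejer (cube N) G) Filter.atTop (nhds G) := by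
    intro G hG
    induction hG using Submodule.span_induction with
    | mem G hG =>
      obtain ⟨γ, x, rfl⟩ := Set.mem_iUnion.1 hG
      simp only [fejer_monomialLp]
      have := (Complex.continuous_ofReal.tendsto 1).comp (tendsto_fejerCoeff_cube γ)
      simpa using this.smul_const (monomialLp X q γ x)
    | zero => simp [fejer]
    | add G H _ _ ihG ihH => simpa only [fejer_add] using ihG.add ihH
    | smul c G _ ihG => simpa only [fejer_smul] using ihG.const_smul c
  rw [Metric.tendsto_atTop]
  intro δ hδ
  obtain ⟨G, hG, hfG⟩ := exists_mem_trigSpan_norm_sub_le hq' f (δ := δ / 4) (by linarith)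
  obtain ⟨N, hN⟩ := Metric.tendsto_atTop.1 (hspan G hG) (δ / 4) (by linarith)
  refine ⟨N, fun n hn => ?_⟩
  have h1 := hN n hn
  rw [dist_eq_norm] at h1 ⊢
  have h2 := norm_fejer_le hq' (cube_nonempty n) (f - G)
  rw [fejer_sub] at h2
  calc ‖fejer (cube n) f - f‖
      = ‖(fejer (cube n) f - fejer (cube n) G) + (fejer (cube n) G - G) - (f - G)‖ := by
        congr 1; abel
    _ ≤ ‖fejer (cube n) f - fejer (cube n) G‖ + ‖fejer (cube n) G - G‖ + ‖f - G‖ :=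
        (norm_sub_le _ _).trans (add_le_add_left (norm_add_le _ _) _)
    _ < δ := by linarith

/-- A function in `L_q(𝕋^ℕ, X)` is determined by its Fourier coefficients. -/
theorem ext_fourierLp [CompleteSpace X] (hq' : q ≠ ∞) {f g : Lp X q polytorusHaar}
    (h : ∀ α, fourierLp X q α f = fourierLp X q α g) : f = g := by
  refine tendsto_nhds_unique (tendsto_fejer hq' f) ?_
  have : ∀ N, fejer (cube N) f = fejer (cube N) g := fun N => by simp only [fejer, h]
  simp only [this]
  exact tendsto_fejer hq' g

end Fejer

/-! ### Unique factorization and the Bohr correspondence -/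

section BohrIndex

theorem coe_bohrIndex (α : ℕ →₀ ℕ) :
    (bohrIndex α : ℕ) = (α.mapDomain (Nat.nth Nat.Prime)).prod (· ^ ·) := by
  rw [Finsupp.prod_mapDomain_index (fun _ => pow_zero _) fun _ _ _ => pow_add _ _ _, bohrIndex,
    Finsupp.prod, Finsupp.prod]
  exact (map_prod PNat.coeMonoidHom _ _).trans
    (Finset.prod_congr rfl fun k _ => PNat.pow_coe (primeSeq k) (α k))

theorem factorization_bohrIndex (α : ℕ →₀ ℕ) :
    (bohrIndex α : ℕ).factorization = α.mapDomain (Nat.nth Nat.Prime) := by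
  classical
  rw [coe_bohrIndex]
  refine Nat.prod_pow_factorization_eq_self fun p hp => ?_
  obtain ⟨k, -, rfl⟩ := Finset.mem_image.1 (Finsupp.mapDomain_support hp)
  exact Nat.prime_nth_prime k

theorem bohrIndex_bijective : Function.Bijective bohrIndex := by
  have hinj : Function.Injective (Nat.nth Nat.Prime) := Nat.nth_injective Nat.infinite_setOfPred_prime
  refine ⟨fun α β h => Finsupp.mapDomain_injective hinj ?_, fun n => ?_⟩
  · rw [← factorization_bohrIndex, ← factorization_bohrIndex, h]
  · refine ⟨Finsupp.comapDomain (Nat.nth Nat.Prime) (n : ℕ).factorization hinj.injOn, ?_⟩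
    apply PNat.coe_injective
    rw [coe_bohrIndex, Finsupp.mapDomain_comapDomain _ hinj]
    · exact Nat.prod_factorization_pow_eq_self n.ne_zero
    · intro p hp
      rw [Nat.range_nth_of_infinite Nat.infinite_setOfPred_prime]
      exact Nat.prime_of_mem_primeFactors hp

theorem bohrIndex_add (α β : ℕ →₀ ℕ) : bohrIndex (α + β) = bohrIndex α * bohrIndex β :=
  Finsupp.prod_add_index' (fun _ => pow_zero _) fun _ _ _ => pow_add _ _ _

/-- The exponent sequence of `n` in its prime factorization. -/
noncomputable def primeExponent (n : ℕ+) : ℕ →₀ ℕ :=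
  (Equiv.ofBijective _ bohrIndex_bijective).symm n

theorem bohrIndex_primeExponent (n : ℕ+) : bohrIndex (primeExponent n) = n :=
  (Equiv.ofBijective _ bohrIndex_bijective).apply_symm_apply n

theorem primeExponent_bohrIndex (α : ℕ →₀ ℕ) : primeExponent (bohrIndex α) = α :=
  (Equiv.ofBijective _ bohrIndex_bijective).symm_apply_apply α

theorem primeExponent_injective : Function.Injective primeExponent :=
  Function.LeftInverse.injective bohrIndex_primeExponent

theorem primeExponent_mul (m n : ℕ+) :
    primeExponent (m * n) = primeExponent m + primeExponent n := by
  apply bohrIndex_bijective.1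
  rw [bohrIndex_add]
  simp only [bohrIndex_primeExponent]

/-- The exponent sequence of `n` in its prime factorization, as a sequence of integers. -/
noncomputable def bohrExponent (n : ℕ+) : ℕ →₀ ℤ :=
  (primeExponent n).mapRange (fun m : ℕ => (m : ℤ)) Nat.cast_zero

theorem bohrExponent_apply (n : ℕ+) (k : ℕ) : bohrExponent n k = primeExponent n k := rfl

theorem bohrExponent_injective : Function.Injective bohrExponent := fun _ _ h =>
  primeExponent_injective (Finsupp.mapRange_injective _ Nat.cast_zero Nat.cast_injective h)

theorem bohrExponent_mul (m n : ℕ+) :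
    bohrExponent (m * n) = bohrExponent m + bohrExponent n := by
  ext k
  simp [bohrExponent_apply, primeExponent_mul]

theorem exists_bohrExponent_eq_or_exists_neg (γ : ℕ →₀ ℤ) :
    (∃ n, bohrExponent n = γ) ∨ ∃ k, γ k < 0 := by
  by_cases h : ∃ k, γ k < 0
  · exact Or.inr h
  · push Not at h
    refine Or.inl ⟨bohrIndex (γ.mapRange Int.toNat rfl), ?_⟩
    ext k
    simp [bohrExponent_apply, primeExponent_bohrIndex, h k]

theorem bohrExponent_ne_of_neg {γ : ℕ →₀ ℤ} (h : ∃ k, γ k < 0) (n : ℕ+) :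
    bohrExponent n ≠ γ := by
  rintro rfl
  obtain ⟨k, hk⟩ := h
  exact absurd hk (by simp [bohrExponent_apply])

end BohrIndex

/-! ### Dirichlet series as functions on the polytorus -/

section Lift

variable {X : Type*} [NormedAddCommGroup X] [NormedSpace ℂ X] {q : ℝ≥0∞} [hq : Fact (1 ≤ q)]

theorem isBohrTransform_iff (f : (ℕ → Circle) → X) (D : ℕ+ → X) :
    IsBohrTransform f D ↔ ∀ n, fourierCoefficient f (bohrExponent n) = D n := by
  refine ⟨fun h n => ?_, fun h α => ?_⟩
  · have := h (primeExponent n)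
    rwa [bohrIndex_primeExponent] at this
  · have := h (bohrIndex α)
    rwa [bohrExponent, primeExponent_bohrIndex] at this

variable (X q) in
/-- The embedding `x ↦ x n^{-s}`, on the side of the polytorus. -/
noncomputable def bohrTerm (n : ℕ+) : X →ₗᵢ[ℂ] Lp X q polytorusHaar :=
  monomialLp X q (bohrExponent n)

/-- `F` is the element of the Hardy space of the polytorus that corresponds to `D`. -/
def IsHardyLift (F : Lp X q polytorusHaar) (D : ℕ+ → X) : Prop :=
  (∀ n, fourierLp X q (bohrExponent n) F = D n) ∧
    ∀ γ : ℕ →₀ ℤ, (∃ k, γ k < 0) → fourierLp X q γ F = 0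

theorem IsHardyLift.unique [CompleteSpace X] (hq' : q ≠ ∞) {F G : Lp X q polytorusHaar}
    {D : ℕ+ → X} (hF : IsHardyLift F D) (hG : IsHardyLift G D) : F = G := by
  refine ext_fourierLp hq' fun γ => ?_
  rcases exists_bohrExponent_eq_or_exists_neg γ with ⟨n, rfl⟩ | h
  · rw [hF.1, hG.1]
  · rw [hF.2 γ h, hG.2 γ h]

/-- Fourier coefficients are continuous on L_q, so the spectral condition passes to limits. -/
theorem IsHardyLift.of_tendsto {F : Lp X q polytorusHaar} {D : ℕ+ → X}
    {G : ℕ → Lp X q polytorusHaar} {D' : ℕ → ℕ+ → X} (hG : ∀ j, IsHardyLift (G j) (D' j))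
    (h : Filter.Tendsto G Filter.atTop (nhds F))
    (hD : ∀ n, Filter.Tendsto (fun j => D' j n) Filter.atTop (nhds (D n))) : IsHardyLift F D := by
  have hc : ∀ γ, Filter.Tendsto (fun j => fourierLp X q γ (G j)) Filter.atTop
      (nhds (fourierLp X q γ F)) := fun γ => ((fourierLp X q γ).continuous.tendsto F).comp h
  refine ⟨fun n => tendsto_nhds_unique (hc _) ?_, fun γ hγ => tendsto_nhds_unique (hc γ) ?_⟩
  · simpa only [(hG _).1] using hD n
  · simp only [(hG _).2 γ hγ, tendsto_const_nhds]

theorem isHardyLift_sum [CompleteSpace X] (S : Finset ℕ+) (x : ℕ+ → X) :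
    IsHardyLift (∑ n ∈ S, bohrTerm X q n (x n)) (∑ n ∈ S, dirichletTerm n (x n)) := by
  refine ⟨fun n => ?_, fun γ hγ => ?_⟩
  · rw [map_sum, Finset.sum_apply]
    refine Finset.sum_congr rfl fun m _ => ?_
    rw [bohrTerm, fourierLp_monomialLp, dirichletTerm, Pi.single_apply]
    simp only [bohrExponent_injective.eq_iff, eq_comm (a := m)]
  · rw [map_sum]
    refine Finset.sum_eq_zero fun m _ => ?_
    rw [bohrTerm, fourierLp_monomialLp, if_neg (bohrExponent_ne_of_neg hγ m)]

theorem mem_dirichletHardy_iff {p : ℝ} [Fact (1 ≤ ENNReal.ofReal p)] {D : ℕ+ → X} :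
    D ∈ dirichletHardy p ↔ ∃ F : Lp X (ENNReal.ofReal p) polytorusHaar, IsHardyLift F D := by
  constructor
  · rintro ⟨f, ⟨hf, hneg⟩, hD⟩
    rw [isBohrTransform_iff] at hD
    exact ⟨hf.toLp f, fun n => (fourierLp_toLp _ hf).trans (hD n),
      fun γ hγ => (fourierLp_toLp _ hf).trans (hneg γ hγ)⟩
  · rintro ⟨F, h1, h2⟩
    exact ⟨F, ⟨Lp.memLp F, h2⟩, (isBohrTransform_iff _ _).2 h1⟩

/-- By uniqueness every competitor in the infimum represents the class of `F`. -/
theorem dirichletHardyNorm_eq [CompleteSpace X] {p : ℝ} [Fact (1 ≤ ENNReal.ofReal p)]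
    {D : ℕ+ → X} {F : Lp X (ENNReal.ofReal p) polytorusHaar} (hF : IsHardyLift F D) :
    dirichletHardyNorm p D = ‖F‖ₑ := by
  refine le_antisymm ?_ ?_
  · refine (iInf₂_le (F : (ℕ → Circle) → X)
      ⟨⟨Lp.memLp F, hF.2⟩, (isBohrTransform_iff _ _).2 hF.1⟩).trans ?_
    rw [Lp.enorm_def]
  · refine le_iInf₂ fun f ⟨⟨hf, hneg⟩, hD⟩ => ?_
    rw [isBohrTransform_iff] at hD
    have hG : IsHardyLift (hf.toLp f) D := ⟨fun n => (fourierLp_toLp _ hf).trans (hD n),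
      fun γ hγ => (fourierLp_toLp _ hf).trans (hneg γ hγ)⟩
    rw [hF.unique ENNReal.ofReal_ne_top hG, Lp.enorm_toLp]

theorem dirichletHardyNorm_sum [CompleteSpace X] {p : ℝ} [Fact (1 ≤ ENNReal.ofReal p)]
    (S : Finset ℕ+) (x : ℕ+ → X) :
    dirichletHardyNorm p (∑ n ∈ S, dirichletTerm n (x n)) =
      ‖∑ n ∈ S, bohrTerm X (ENNReal.ofReal p) n (x n)‖ₑ :=
  dirichletHardyNorm_eq (isHardyLift_sum S x)

theorem sum_bohrTerm_smul (S : Finset ℕ+) (x : ℕ+ → X) (ε : ℕ+ → ℤˣ) :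
    ∑ n ∈ S, bohrTerm X q n (ε n • x n) = signSum S (fun n => bohrTerm X q n (x n)) ε := by
  refine Finset.sum_congr rfl fun n _ => ?_
  rcases Int.units_eq_one_or (ε n) with h | h <;> simp [h]

theorem dirichletHardyRadNorm_sum [CompleteSpace X] {p : ℝ} [Fact (1 ≤ ENNReal.ofReal p)]
    (S : Finset ℕ+) (x : ℕ+ → X) :
    dirichletHardyRadNorm p (∑ n ∈ S, dirichletTerm n (x n)) =
      ∫⁻ ε, ‖signSum S (fun n => bohrTerm X (ENNReal.ofReal p) n (x n)) ε‖ₑ ∂signMeasure := by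
  refine lintegral_congr fun ε => ?_
  rw [← sum_bohrTerm_smul, ← dirichletHardyNorm_sum]
  congr 1
  ext n
  rw [Finset.sum_apply, Finset.sum_apply, Finset.smul_sum]
  refine Finset.sum_congr rfl fun m _ => ?_
  by_cases h : n = m
  · subst h; simp [dirichletTerm]
  · simp [dirichletTerm, h]

/-- The Fejér means of an element of the Hardy space are Dirichlet polynomials. -/
theorem IsHardyLift.fejer_eq {F : Lp X q polytorusHaar} {D : ℕ+ → X} (hF : IsHardyLift F D)
    (A : Finset (ℕ →₀ ℤ)) :
    fejer A F = ∑ n ∈ ((A ×ˢ A).image fun i => i.1 - i.2).preimage bohrExponent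
      bohrExponent_injective.injOn, fejerCoeff A (bohrExponent n) • bohrTerm X q n (D n) := by
  classical
  rw [DirichletRUC.fejer_eq]
  have h : ∀ n, fejerCoeff A (bohrExponent n) • bohrTerm X q n (D n) =
      (fejerCoeff A (bohrExponent n) : ℂ) • monomialLp X q (bohrExponent n)
        (fourierLp X q (bohrExponent n) F) := fun n => by
    rw [hF.1 n]
    exact (algebraMap_smul ℂ (fejerCoeff A (bohrExponent n)) (bohrTerm X q n (D n))).symm
  simp only [h]
  rw [Finset.sum_preimage bohrExponent _ bohrExponent_injective.injOn
    fun γ => (fejerCoeff A γ : ℂ) • monomialLp X q γ (fourierLp X q γ F)]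
  intro γ _ hγ
  rcases exists_bohrExponent_eq_or_exists_neg γ with h | h
  · exact absurd h hγ
  · rw [hF.2 γ h, map_zero, smul_zero]

theorem coeFn_sum_bohrTerm {ι : Type*} (s : Finset ι) (a : ι → ℕ+) (x : ι → X) :
    (∑ i ∈ s, bohrTerm X q (a i) (x i) : Lp X q polytorusHaar) =ᵐ[polytorusHaar]
      fun w => ∑ i ∈ s, torusChar (bohrExponent (a i)) w • x i :=
  coeFn_sum_monomialLp s _ x

/-- Multiplying all indices by m multiplies the function by a unimodular character. This is what
lets polynomials be moved to disjoint blocks. -/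
theorem enorm_sum_bohrTerm_mul (m : ℕ+) (S : Finset ℕ+) (x : ℕ+ → X) :
    ‖∑ n ∈ S, bohrTerm X q (m * n) (x n)‖ₑ = ‖∑ n ∈ S, bohrTerm X q n (x n)‖ₑ := by
  rw [Lp.enorm_def, Lp.enorm_def]
  refine eLpNorm_congr_norm_ae ?_
  filter_upwards [coeFn_sum_bohrTerm (q := q) S (fun n => m * n) x,
    coeFn_sum_bohrTerm (q := q) S (fun n => n) x] with w h1 h2
  rw [h1, h2]
  simp only [bohrExponent_mul, torusChar_add, mul_smul, ← Finset.smul_sum, norm_smul,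
    norm_torusChar, one_mul]

end Lift

/-! ### The uniform bound and the gliding hump -/

section Equivalences

theorem sum_image_invFunOn {X M : Type*} [AddCommMonoid M] {S : Finset ℕ+}
    {φ : ℕ+ → ℕ+} (hφ : Set.InjOn φ S) (x : ℕ+ → X) (G : ℕ+ → X → M) :
    ∑ l ∈ S.image φ, G l (x (Function.invFunOn φ S l)) = ∑ n ∈ S, G (φ n) (x n) := by
  rw [Finset.sum_image hφ]
  refine Finset.sum_congr rfl fun n hn => ?_
  rw [hφ.leftInvOn_invFunOn hn]

variable {X : Type*} [NormedAddCommGroup X] [NormedSpace ℂ X] {q : ℝ≥0∞} [hq : Fact (1 ≤ q)]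

variable (X q) in
/-- The inequality `‖∑ xₙ n^{-s}‖_{rad} ≤ C ‖∑ xₙ n^{-s}‖` for arbitrary finite sets of indices. -/
def RadBound (C : ℝ≥0) : Prop :=
  ∀ (S : Finset ℕ+) (x : ℕ+ → X),
    ∫⁻ ε, ‖signSum S (fun n => bohrTerm X q n (x n)) ε‖ₑ ∂signMeasure ≤
      C * ‖∑ n ∈ S, bohrTerm X q n (x n)‖ₑ

theorem RadBound.of_Icc {C : ℝ≥0} (h : ∀ (N : ℕ+) (x : ℕ+ → X),
    ∫⁻ ε, ‖signSum (Finset.Icc 1 N) (fun n => bohrTerm X q n (x n)) ε‖ₑ ∂signMeasure ≤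
      C * ‖∑ n ∈ Finset.Icc 1 N, bohrTerm X q n (x n)‖ₑ) : RadBound X q C := by
  intro S x
  obtain ⟨N, hN⟩ := S.bddAbove
  have hS : S ⊆ Finset.Icc 1 N := fun n hn => Finset.mem_Icc.2 ⟨one_le, hN hn⟩
  have := h N fun n => if n ∈ S then x n else 0
  have e1 : ∑ n ∈ Finset.Icc 1 N, bohrTerm X q n (if n ∈ S then x n else 0) =
      ∑ n ∈ S, bohrTerm X q n (x n) := by
    rw [← Finset.sum_subset hS fun n _ hn => by simp [hn]]
    exact Finset.sum_congr rfl fun n hn => by simp [hn]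
  have e2 : ∀ ε, signSum (Finset.Icc 1 N) (fun n => bohrTerm X q n (if n ∈ S then x n else 0)) ε =
      signSum S (fun n => bohrTerm X q n (x n)) ε := fun ε => by
    rw [signSum, ← Finset.sum_subset hS fun n _ hn => by simp [hn]]
    exact Finset.sum_congr rfl fun n hn => by simp [hn]
  simpa only [e1, e2] using this

theorem RadBound.reindex {C : ℝ≥0} (h : RadBound X q C) {S : Finset ℕ+} {φ : ℕ+ → ℕ+}
    (hφ : Set.InjOn φ S) (x : ℕ+ → X) :
    ∫⁻ ε, ‖signSum S (fun n => bohrTerm X q (φ n) (x n)) ε‖ₑ ∂signMeasure ≤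
      C * ‖∑ n ∈ S, bohrTerm X q (φ n) (x n)‖ₑ := by
  have := h (S.image φ) fun l => x (Function.invFunOn φ S l)
  rw [sum_image_invFunOn hφ x fun l => bohrTerm X q l] at this
  refine le_trans (le_of_eq ?_) this
  rw [← lintegral_signSum_reindex S _ hφ fun v => ‖v‖ₑ]
  refine lintegral_congr fun ε => ?_
  rw [signSum, sum_image_invFunOn hφ x fun l v => ε l • bohrTerm X q l v]

/-- If there is no uniform bound, then polynomials with increasingly large ratio of the norms can
be placed on disjoint blocks of indices. -/
theorem exists_blocks_of_not_radBound (h : ¬ ∃ C, RadBound X q C) :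
    ∃ (x : ℕ+ → X) (T : ℕ → Finset ℕ+), Pairwise (Function.onFun Disjoint T) ∧
      (∀ l, (∀ k, l ∉ T k) → x l = 0) ∧
      ∀ k, ‖∑ n ∈ T k, bohrTerm X q n (x n)‖ ≤ (1 / 2) ^ k ∧
        (2 : ℝ≥0∞) ^ k ≤ ∫⁻ ε, ‖signSum (T k) (fun n => bohrTerm X q n (x n)) ε‖ₑ ∂signMeasure := by
  classical
  have h1 : ∀ k : ℕ, ∃ (S : Finset ℕ+) (x : ℕ+ → X),
      ‖∑ n ∈ S, bohrTerm X q n (x n)‖ ≤ (1 / 2) ^ k ∧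
        (2 : ℝ≥0∞) ^ k ≤ ∫⁻ ε, ‖signSum S (fun n => bohrTerm X q n (x n)) ε‖ₑ ∂signMeasure := by
    intro k
    obtain ⟨S, x, hSx⟩ : ∃ (S : Finset ℕ+) (x : ℕ+ → X),
        ((4 ^ k : ℝ≥0) : ℝ≥0∞) * ‖∑ n ∈ S, bohrTerm X q n (x n)‖ₑ <
          ∫⁻ ε, ‖signSum S (fun n => bohrTerm X q n (x n)) ε‖ₑ ∂signMeasure := by
      by_contra hcon
      push Not at hcon
      exact h ⟨4 ^ k, hcon⟩
    set R := ∫⁻ ε, ‖signSum S (fun n => bohrTerm X q n (x n)) ε‖ₑ ∂signMeasure with hR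
    have hRtop : R ≠ ∞ := (lintegral_enorm_signSum_lt_top S _).ne
    have hR0 : 0 < R.toReal := ENNReal.toReal_pos (ne_bot_of_gt hSx) hRtop
    have hnorm : 4 ^ k * ‖∑ n ∈ S, bohrTerm X q n (x n)‖ ≤ R.toReal := by
      have := ENNReal.toReal_mono hRtop hSx.le
      simpa using this
    -- Scaling makes the Rademacher mean equal to 2^k; the ratio above 4^k then leaves a norm of at
    -- most 2^{-k}.
    set s : ℝ := 2 ^ k / R.toReal with hs
    have hs0 : 0 < s := by positivity
    refine ⟨S, fun n => (s : ℂ) • x n, ?_, ?_⟩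
    · simp only [map_smul, ← Finset.smul_sum, norm_smul, Complex.norm_real,
        Real.norm_of_nonneg hs0.le]
      calc s * ‖∑ n ∈ S, bohrTerm X q n (x n)‖
          ≤ s * (R.toReal / 4 ^ k) := by
            gcongr
            rw [le_div_iff₀ (by positivity), mul_comm]
            exact hnorm
        _ = (1 / 2) ^ k := by
            rw [hs, show (4 : ℝ) = 2 * 2 by norm_num, mul_pow]
            field_simp
            rw [← mul_pow]
            norm_num
    · have e : ∀ ε, signSum S (fun n => bohrTerm X q n ((s : ℂ) • x n)) ε =
          (s : ℂ) • signSum S (fun n => bohrTerm X q n (x n)) ε := fun ε => by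
        simp only [signSum, Finset.smul_sum, map_smul, smul_comm (s : ℂ)]
      simp only [e, enorm_smul]
      rw [lintegral_const_mul _ (measurable_comp_signSum S _ fun v => ‖v‖ₑ), ← hR,
        ← ENNReal.ofReal_toReal hRtop, ← ofReal_norm, Complex.norm_real,
        Real.norm_of_nonneg hs0.le, ← ENNReal.ofReal_mul hs0.le, hs, div_mul_cancel₀ _ hR0.ne',
        ENNReal.ofReal_pow (by norm_num)]
      simp
  choose S x hnorm hrad using h1
  choose M hM using fun k => (S k).bddAbove
  -- Each block multiplied by m j ends strictly before m (j + 1), where the next one may begin at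
  -- the earliest.
  let m : ℕ → ℕ+ := fun k => ∏ j ∈ Finset.range k, (M j + 1)
  have hmlt : ∀ j k, j < k → ∀ n ∈ S j, m j * n < m k := by
    intro j k hjk n hn
    have hmono : m (j + 1) ∣ m k := Finset.prod_dvd_prod_of_subset _ _ _
      (Finset.range_subset_range.2 hjk)
    refine lt_of_lt_of_le ?_ (PNat.le_of_dvd hmono)
    simp only [m, Finset.prod_range_succ]
    exact mul_lt_mul_right (PNat.lt_add_one_iff.2 (hM j hn)) _
  let T : ℕ → Finset ℕ+ := fun k => (S k).image (m k * ·)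
  have hle : ∀ k (n : ℕ+), m k ≤ m k * n := fun k n => le_mul_of_one_le_right' one_le
  have huniq : ∀ j k n n', n ∈ S j → n' ∈ S k → m j * n = m k * n' → j = k ∧ n = n' := by
    intro j k n n' hn hn' e
    have hjk : j = k := by
      rcases lt_trichotomy j k with hlt | rfl | hlt
      · exact absurd e ((hmlt j k hlt n hn).trans_le (hle k n')).ne
      · rfl
      · exact absurd e ((hmlt k j hlt n' hn').trans_le (hle j n)).ne'
    subst hjk
    exact ⟨rfl, mul_left_cancel e⟩
  let P : ℕ+ → ℕ × ℕ+ → Prop := fun l i => i.2 ∈ S i.1 ∧ m i.1 * i.2 = l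
  let y : ℕ+ → X := fun l => if hl : ∃ i, P l i then x hl.choose.1 hl.choose.2 else 0
  have hy : ∀ k, ∀ n ∈ S k, y (m k * n) = x k n := by
    intro k n hn
    have hl : ∃ i, P (m k * n) i := ⟨(k, n), hn, rfl⟩
    obtain ⟨h1, h2⟩ := huniq _ _ _ _ hl.choose_spec.1 hn hl.choose_spec.2
    simp only [y, dif_pos hl, h2]
    rw [h1]
  have hinj : ∀ k, Set.InjOn (m k * ·) (S k : Set ℕ+) := fun k _ _ _ _ e => mul_left_cancel e
  refine ⟨y, T, ?_, ?_, fun k => ⟨?_, ?_⟩⟩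
  · intro j k hjk
    rw [Function.onFun, Finset.disjoint_left]
    rintro l hj hk
    obtain ⟨n, hn, rfl⟩ := Finset.mem_image.1 hj
    obtain ⟨n', hn', e⟩ := Finset.mem_image.1 hk
    exact hjk (huniq j k n n' hn hn' e.symm).1
  · intro l hl
    refine dif_neg ?_
    rintro ⟨i, hi, rfl⟩
    exact hl i.1 (Finset.mem_image_of_mem _ hi)
  · rw [Finset.sum_image (hinj k), Finset.sum_congr rfl fun n hn => by rw [hy k n hn]]
    refine le_trans (le_of_eq ?_) (hnorm k)
    rw [← toReal_enorm, enorm_sum_bohrTerm_mul (m k) (S k) (x k), toReal_enorm]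
  · refine (hrad k).trans (le_of_eq ?_)
    rw [← lintegral_signSum_reindex (S k) _ (hinj k) fun v => ‖v‖ₑ]
    refine lintegral_congr fun ε => ?_
    have e1 : ∑ n ∈ S k, ε (m k * n) • bohrTerm X q n (x k n) =
        ∑ n ∈ S k, bohrTerm X q n (ε (m k * n) • x k n) :=
      (sum_bohrTerm_smul (S k) (x k) fun n => ε (m k * n)).symm
    rw [e1, ← enorm_sum_bohrTerm_mul (m k) (S k) fun n => ε (m k * n) • x k n,
      ← sum_bohrTerm_smul, Finset.sum_image (hinj k)]
    congr 1
    exact Finset.sum_congr rfl fun n hn => by rw [hy k n hn]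

/-- The blockwise argument for unconditionality of all sequences of one-term series. -/
theorem exists_radBound_of_forall_sequence
    (h : ∀ x : ℕ+ → X, ∃ C : ℝ≥0, ∀ S : Finset ℕ+,
      ∫⁻ ε, ‖signSum S (fun n => bohrTerm X q n (x n)) ε‖ₑ ∂signMeasure ≤
        C * ‖∑ n ∈ S, bohrTerm X q n (x n)‖ₑ) : ∃ C, RadBound X q C := by
  by_contra hcon
  obtain ⟨x, T, -, -, hT⟩ := exists_blocks_of_not_radBound hcon
  obtain ⟨C, hC⟩ := h x
  obtain ⟨k, hk⟩ := pow_unbounded_of_one_lt (C : ℝ) (one_lt_two)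
  have h1 := (hT k).2.trans (hC (T k))
  have h2 : ‖∑ n ∈ T k, bohrTerm X q n (x n)‖ₑ ≤ 1 := by
    rw [← ofReal_norm]
    refine ENNReal.ofReal_le_one.2 ((hT k).1.trans (pow_le_one₀ (by norm_num) (by norm_num)))
  have h3 : (2 : ℝ≥0∞) ^ k ≤ C := h1.trans (mul_le_of_le_one_right' h2)
  have h4 : (2 : ℝ≥0) ^ k ≤ C := by exact_mod_cast h3
  exact absurd hk (not_lt.2 (by exact_mod_cast h4))

/-- The weights and vectors do not depend on ε, so the means of the random lifts are Rademacher sums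
and no measurable choice of the lifts is required. -/
theorem fejer_eq_signSum {F : Lp X q polytorusHaar} {D : ℕ+ → X} {ε : ℕ+ → ℤˣ}
    (hF : IsHardyLift F fun n => ε n • D n) (A : Finset (ℕ →₀ ℤ)) :
    fejer A F = signSum (((A ×ˢ A).image fun i => i.1 - i.2).preimage bohrExponent
      bohrExponent_injective.injOn)
        (fun n => fejerCoeff A (bohrExponent n) • bohrTerm X q n (D n)) ε := by
  rw [hF.fejer_eq]
  refine Finset.sum_congr rfl fun n _ => ?_
  rcases Int.units_eq_one_or (ε n) with h | h <;> simp [h]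

/-- If almost every sign change of a Hardy function is again one, then a uniform bound holds. -/
theorem exists_radBound_of_subset [CompleteSpace X] (hq' : q ≠ ∞)
    (h : ∀ (D : ℕ+ → X) (F : Lp X q polytorusHaar), IsHardyLift F D →
      ∀ᵐ ε ∂signMeasure, ∃ G : Lp X q polytorusHaar, IsHardyLift G fun n => ε n • D n) :
    ∃ C, RadBound X q C := by
  by_contra hcon
  obtain ⟨x, T, hdisj, hzero, hT⟩ := exists_blocks_of_not_radBound hcon
  let P : ℕ → Lp X q polytorusHaar := fun k => ∑ n ∈ T k, bohrTerm X q n (x n)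
  have hsum : Summable P := Summable.of_norm_bounded
    (summable_geometric_of_lt_one (by norm_num) (by norm_num)) fun k => (hT k).1
  -- The blocks are absolutely summable, and each coefficient becomes constant along the partial
  -- sums because an index lies in at most one block.
  have hlift : IsHardyLift (∑' k, P k) x := by
    refine IsHardyLift.of_tendsto (fun N => ?_) hsum.hasSum.tendsto_sum_nat (D' := fun N =>
      ∑ k ∈ Finset.range N, ∑ n ∈ T k, dirichletTerm n (x n)) fun n => ?_
    · refine ⟨fun n => ?_, fun γ hγ => ?_⟩
      · rw [map_sum, Finset.sum_apply]
        exact Finset.sum_congr rfl fun k _ => (isHardyLift_sum (T k) x).1 n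
      · rw [map_sum]
        exact Finset.sum_eq_zero fun k _ => (isHardyLift_sum (T k) x).2 γ hγ
    · have hterm : ∀ k, (∑ m ∈ T k, dirichletTerm m (x m)) n = if n ∈ T k then x n else 0 := by
        intro k
        rw [Finset.sum_apply]
        simp [dirichletTerm, Pi.single_apply]
      rw [show (fun N => (∑ k ∈ Finset.range N, ∑ m ∈ T k, dirichletTerm m (x m)) n) =
        fun N => ∑ k ∈ Finset.range N, if n ∈ T k then x n else 0 from
          funext fun N => by rw [Finset.sum_apply]; exact Finset.sum_congr rfl fun k _ => hterm k]
      by_cases hn : ∃ k, n ∈ T k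
      · obtain ⟨k, hk⟩ := hn
        have hk' : ∀ j, j ≠ k → (if n ∈ T j then x n else 0) = 0 := fun j hj =>
          if_neg fun hj' => Finset.disjoint_left.1 (hdisj hj) hj' hk
        have := hasSum_single k hk'
        rw [if_pos hk] at this
        exact this.tendsto_sum_nat
      · push Not at hn
        simp [hn, hzero n hn]
  have hae := h x _ hlift
  -- The summation method is Fejér's; its contractivity bounds all means of the lift `G` by its
  -- norm. The resulting bound `M` on every Rademacher mean contradicts the growth 2^k on the
  -- blocks.
  obtain ⟨M, hM⟩ := exists_lintegral_signSum_le_of_ae_bounded (fun n => bohrTerm X q n (x n))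
    (fun N => ((cube N ×ˢ cube N).image fun i => i.1 - i.2).preimage bohrExponent
      bohrExponent_injective.injOn) (fun N n => fejerCoeff (cube N) (bohrExponent n))
    (fun N n hn => fejerCoeff_eq_zero (by simpa using hn))
    (fun n => tendsto_fejerCoeff_cube _) (by
      filter_upwards [hae] with ε ⟨G, hG⟩
      refine ⟨‖G‖₊, fun N => ?_⟩
      rw [← fejer_eq_signSum hG]
      exact enorm_le_iff_norm_le.2 (norm_fejer_le hq' (cube_nonempty N) G))
  obtain ⟨k, hk⟩ := pow_unbounded_of_one_lt (M : ℝ) (one_lt_two)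
  have h1 := (hT k).2.trans (hM (T k))
  have h4 : (2 : ℝ≥0) ^ k ≤ M := by exact_mod_cast h1
  exact absurd hk (not_lt.2 (by exact_mod_cast h4))

end Equivalences

/-! ### Almost sure membership from the uniform bound -/

section Converse

variable {X : Type*} [NormedAddCommGroup X] [NormedSpace ℂ X] {q : ℝ≥0∞} [hq : Fact (1 ≤ q)]

theorem real_smul_bohrTerm (n : ℕ+) (c : ℝ) (x : X) :
    c • bohrTerm X q n x = bohrTerm X q n ((c : ℂ) • x) := by
  rw [map_smul]
  exact (algebraMap_smul ℂ c (bohrTerm X q n x)).symm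

theorem RadBound.lintegral_smul_le {C : ℝ≥0} (h : RadBound X q C) (S : Finset ℕ+) (c : ℕ+ → ℝ)
    (x : ℕ+ → X) :
    ∫⁻ ε, ‖signSum S (fun n => c n • bohrTerm X q n (x n)) ε‖ₑ ∂signMeasure ≤
      C * ‖∑ n ∈ S, c n • bohrTerm X q n (x n)‖ₑ := by
  simp only [real_smul_bohrTerm]
  exact h S _

/-- A uniform bound implies that almost every sign change of a Hardy function is again one. -/
theorem RadBound.ae_exists_isHardyLift [CompleteSpace X] (hq' : q ≠ ∞) {C : ℝ≥0}
    (h : RadBound X q C) {D : ℕ+ → X} {F : Lp X q polytorusHaar} (hF : IsHardyLift F D) :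
    ∀ᵐ ε ∂signMeasure, ∃ G : Lp X q polytorusHaar, IsHardyLift G fun n => ε n • D n := by
  classical
  have hchoose : ∀ j : ℕ, ∃ N, ∀ n ≥ N, ‖fejer (cube n) F - F‖ ≤ (1 / 2) ^ j := fun j => by
    obtain ⟨N, hN⟩ := Metric.tendsto_atTop.1 (tendsto_fejer hq' F) ((1 / 2) ^ j) (by positivity)
    exact ⟨N, fun n hn => by rw [← dist_eq_norm]; exact (hN n hn).le⟩
  choose N hN using hchoose
  -- Large enough for the rate (1/2)^j, and the summand j forces L j → ∞, so that the weights tend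
  -- to 1.
  let L : ℕ → ℕ := fun j => N j + j
  have hL : Filter.Tendsto L Filter.atTop Filter.atTop :=
    Filter.tendsto_atTop_mono (fun j => Nat.le_add_left j (N j)) Filter.tendsto_id
  let T : ℕ → Finset ℕ+ := fun j => ((cube (L j) ×ˢ cube (L j)).image fun i => i.1 - i.2).preimage
    bohrExponent bohrExponent_injective.injOn
  let c : ℕ → ℕ+ → ℝ := fun j n => fejerCoeff (cube (L j)) (bohrExponent n)
  have hcT : ∀ j, ∀ n ∉ T j, c j n = 0 := fun j n hn => fejerCoeff_eq_zero (by simpa [T] using hn)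
  let y : ℕ+ → Lp X q polytorusHaar := fun n => bohrTerm X q n (D n)
  let v : ℕ → (ℕ+ → ℤˣ) → Lp X q polytorusHaar := fun j => signSum (T j) fun n => c j n • y n
  have hv : ∀ j ε, v j ε = signSum (T (j + 1) ∪ T j) (fun n => c j n • y n) ε := fun j ε =>
    Finset.sum_subset Finset.subset_union_right fun n _ hn => by simp [hcT j n hn]
  have hv' : ∀ j ε, v (j + 1) ε = signSum (T (j + 1) ∪ T j) (fun n => c (j + 1) n • y n) ε :=
    fun j ε => Finset.sum_subset Finset.subset_union_left fun n _ hn => by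
      simp [hcT (j + 1) n hn]
  have hdiff : ∀ j ε, v (j + 1) ε - v j ε =
      signSum (T (j + 1) ∪ T j) (fun n => (c (j + 1) n - c j n) • y n) ε := fun j ε => by
    rw [hv', hv j, signSum, signSum, signSum, ← Finset.sum_sub_distrib]
    exact Finset.sum_congr rfl fun n _ => by rw [sub_smul, smul_sub]
  -- With all signs equal to 1 the random means are those of `F`, so the right side of the uniform
  -- bound is a difference of two Fejér means of `F`.
  have hG : ∀ j, fejer (cube (L j)) F = v j 1 := fun j => by
    rw [hF.fejer_eq]
    exact Finset.sum_congr rfl fun n _ => by simp [c, y]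
  have hE : ∀ j, ∫⁻ ε, ‖v (j + 1) ε - v j ε‖ₑ ∂signMeasure ≤
      C * (2 * ENNReal.ofReal ((1 / 2) ^ j)) := fun j => by
    simp only [hdiff]
    refine (h.lintegral_smul_le _ _ D).trans (mul_le_mul_right ?_ _)
    have e : ∑ n ∈ T (j + 1) ∪ T j, (c (j + 1) n - c j n) • bohrTerm X q n (D n) =
        fejer (cube (L (j + 1))) F - fejer (cube (L j)) F := by
      rw [hG, hG, hdiff]
      exact Finset.sum_congr rfl fun n _ => by simp [y]
    rw [e, ← ofReal_norm, ← ENNReal.ofReal_ofNat, ← ENNReal.ofReal_mul (by norm_num)]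
    refine ENNReal.ofReal_le_ofReal ?_
    have h1 := hN j (L j) (Nat.le_add_right _ _)
    have h2 := hN (j + 1) (L (j + 1)) (Nat.le_add_right _ _)
    have h3 : ((1 : ℝ) / 2) ^ (j + 1) ≤ (1 / 2) ^ j :=
      pow_le_pow_of_le_one (by norm_num) (by norm_num) (Nat.le_succ j)
    calc ‖fejer (cube (L (j + 1))) F - fejer (cube (L j)) F‖
        = ‖(fejer (cube (L (j + 1))) F - F) - (fejer (cube (L j)) F - F)‖ := by
          rw [sub_sub_sub_cancel_right]
      _ ≤ _ := (norm_sub_le _ _).trans (by linarith)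
  have hmeas : ∀ j, Measurable fun ε => ‖v (j + 1) ε - v j ε‖ₑ := fun j => by
    simp only [hdiff]
    exact measurable_comp_signSum _ _ fun w => ‖w‖ₑ
  -- Finite expectation of the total variation makes the random means Cauchy for almost every ε.
  have hsum : ∫⁻ ε, ∑' j, ‖v (j + 1) ε - v j ε‖ₑ ∂signMeasure ≠ ∞ := by
    rw [lintegral_tsum fun j => (hmeas j).aemeasurable]
    refine ((ENNReal.tsum_le_tsum hE).trans_lt ?_).ne
    rw [ENNReal.tsum_mul_left, ENNReal.tsum_mul_left, ← ENNReal.ofReal_tsum_of_nonneg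
      (fun j => by positivity) (summable_geometric_of_lt_one (by norm_num) (by norm_num))]
    finiteness
  filter_upwards [ae_lt_top (Measurable.tsum hmeas) hsum] with ε hε
  have hcauchy : CauchySeq fun j => v j ε := by
    refine cauchySeq_of_edist_le_of_tsum_ne_top (fun j => ‖v (j + 1) ε - v j ε‖ₑ) (fun j => ?_)
      hε.ne
    rw [edist_comm, edist_eq_enorm_sub]
  obtain ⟨G, hGlim⟩ := cauchySeq_tendsto_of_complete hcauchy
  refine ⟨G, IsHardyLift.of_tendsto (D' := fun j => ∑ n ∈ T j, dirichletTerm n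
    (ε n • (c j n : ℂ) • D n)) (fun j => ?_) hGlim fun n => ?_⟩
  · have e : v j ε = ∑ n ∈ T j, bohrTerm X q n (ε n • (c j n : ℂ) • D n) := by
      rw [sum_bohrTerm_smul]
      exact Finset.sum_congr rfl fun n _ => congrArg (ε n • ·) (real_smul_bohrTerm n _ _)
    rw [e]
    exact isHardyLift_sum _ _
  · have e : ∀ j, (∑ m ∈ T j, dirichletTerm m (ε m • (c j m : ℂ) • D m)) n =
        (c j n : ℂ) • ε n • D n := fun j => by
      rw [Finset.sum_apply]
      by_cases hn : n ∈ T j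
      · simp [dirichletTerm, Pi.single_apply, hn, smul_comm (ε n)]
      · simp [dirichletTerm, Pi.single_apply, hn, hcT j n hn]
    simp only [e]
    have hc1 : Filter.Tendsto (fun j => c j n) Filter.atTop (nhds 1) :=
      (tendsto_fejerCoeff_cube (bohrExponent n)).comp hL
    have := (Complex.continuous_ofReal.tendsto 1).comp hc1
    simpa using this.smul_const (ε n • D n)

end Converse

/-! ### From Dirichlet series to power series -/

section PowerSeries

/-- Here `primeSeq 0` is 2: Dirichlet series over the powers of 2 involve only the first coordinate
of the polytorus. -/
theorem bohrExponent_two_pow (n : ℕ) : bohrExponent (primeSeq 0 ^ n) = Finsupp.single 0 (n : ℤ) := by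
  have : primeSeq 0 ^ n = bohrIndex (Finsupp.single 0 n) := by
    simp [bohrIndex]
  rw [bohrExponent, this, primeExponent_bohrIndex, Finsupp.mapRange_single]

theorem stronglyMeasurable_sign_char {X : Type*} [NormedAddCommGroup X] [NormedSpace ℂ X]
    (S : Finset ℕ+) (a : ℕ+ → ℕ →₀ ℤ) (x : ℕ+ → X) :
    StronglyMeasurable fun i : (ℕ+ → ℤˣ) × (ℕ → Circle) =>
      ∑ n ∈ S, i.1 n • torusChar (a n) i.2 • x n := by
  refine Finset.stronglyMeasurable_fun_sum _ fun n _ => ?_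
  have e : ∀ i : (ℕ+ → ℤˣ) × (ℕ → Circle), i.1 n • torusChar (a n) i.2 • x n =
      (((i.1 n : ℤ) : ℂ) * torusChar (a n) i.2) • x n := fun i => by
    rcases Int.units_eq_one_or (i.1 n) with h | h <;> simp [h]
  simp only [e]
  refine Measurable.stronglyMeasurable (Measurable.mul ?_ ?_) |>.smul_const _
  · exact (measurable_of_countable fun u : ℤˣ => ((u : ℤ) : ℂ)).comp
      ((measurable_pi_apply n).comp measurable_fst)
  · exact (continuous_torusChar (a n)).measurable.comp measurable_snd

variable {X : Type*} [NormedAddCommGroup X] [NormedSpace ℂ X] {p : ℝ}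

theorem enorm_sum_bohrTerm_rpow (hp : 1 ≤ p) [Fact (1 ≤ ENNReal.ofReal p)] (S : Finset ℕ+)
    (a : ℕ+ → ℕ+) (x : ℕ+ → X) :
    ‖∑ n ∈ S, bohrTerm X (ENNReal.ofReal p) (a n) (x n)‖ₑ ^ p =
      ∫⁻ w, ‖∑ n ∈ S, torusChar (bohrExponent (a n)) w • x n‖ₑ ^ p ∂polytorusHaar := by
  have hp0 : 0 < p := by linarith
  rw [Lp.enorm_def, eLpNorm_congr_ae (coeFn_sum_bohrTerm S a x),
    eLpNorm_eq_lintegral_rpow_enorm_toReal (ENNReal.ofReal_pos.2 hp0).ne' ENNReal.ofReal_ne_top,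
    ENNReal.toReal_ofReal hp0.le, ← ENNReal.rpow_mul, one_div_mul_cancel hp0.ne', ENNReal.rpow_one]

theorem enorm_sum_bohrTerm_rpow_eq_circle (hp : 1 ≤ p) [Fact (1 ≤ ENNReal.ofReal p)]
    (S : Finset ℕ+) (x : ℕ+ → X) :
    ‖∑ n ∈ S, bohrTerm X (ENNReal.ofReal p) (primeSeq 0 ^ (n : ℕ)) (x n)‖ₑ ^ p =
      ∫⁻ z : Circle, ‖∑ n ∈ S, (z : ℂ) ^ (n : ℕ) • x n‖ₑ ^ p ∂circleHaar := by
  rw [enorm_sum_bohrTerm_rpow hp]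
  simp only [bohrExponent_two_pow, torusChar_single, zpow_natCast]
  have hcoe : Continuous fun z : Circle => (z : ℂ) := continuous_subtype_val
  exact (measurePreserving_eval_infinitePi (fun _ : ℕ => circleHaar) 0).lintegral_comp
    (f := fun z : Circle => ‖∑ n ∈ S, (z : ℂ) ^ (n : ℕ) • x n‖ₑ ^ p)
    ((Continuous.enorm (by fun_prop)).measurable.pow_const p)

theorem lintegral_enorm_le_enorm {X : Type*} [NormedAddCommGroup X] {q : ℝ≥0∞} [hq : Fact (1 ≤ q)] (F : Lp X q polytorusHaar) :
    ∫⁻ w, ‖F w‖ₑ ∂polytorusHaar ≤ ‖F‖ₑ := by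
  rw [Lp.enorm_def, ← eLpNorm_one_eq_lintegral_enorm]
  exact eLpNorm_le_eLpNorm_of_exponent_le hq.out (Lp.aestronglyMeasurable F)

/-- A uniform bound for Dirichlet series implies one for power series. -/
theorem RadBound.circle (hp : 1 ≤ p) [Fact (1 ≤ ENNReal.ofReal p)] {C : ℝ≥0}
    (h : RadBound X (ENNReal.ofReal p) C) (S : Finset ℕ+) (x : ℕ+ → X) :
    ∫⁻ ε, ‖signSum S x ε‖ₑ ∂signMeasure ≤ 2 * C *
      (∫⁻ z : Circle, ‖∑ n ∈ S, (z : ℂ) ^ (n : ℕ) • x n‖ₑ ^ p ∂circleHaar) ^ (1 / p) := by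
  have hp0 : 0 < p := by linarith
  have hφ : Set.InjOn (fun n : ℕ+ => primeSeq 0 ^ (n : ℕ)) S := by
    intro m _ n _ hmn
    have h1 := congrArg bohrExponent hmn
    simp only [bohrExponent_two_pow] at h1
    exact PNat.coe_injective (by exact_mod_cast Finsupp.single_injective _ h1)
  rw [← enorm_sum_bohrTerm_rpow_eq_circle hp, ← ENNReal.rpow_mul, mul_one_div_cancel hp0.ne',
    ENNReal.rpow_one, mul_assoc]
  refine le_trans ?_ (mul_le_mul_right (h.reindex hφ x) 2)
  let a : ℕ+ → ℕ →₀ ℤ := fun n => bohrExponent (primeSeq 0 ^ (n : ℕ))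
  have h1 : ∀ ε, ∫⁻ w, ‖∑ n ∈ S, ε n • torusChar (a n) w • x n‖ₑ ∂polytorusHaar ≤
      ‖signSum S (fun n => bohrTerm X (ENNReal.ofReal p) (primeSeq 0 ^ (n : ℕ)) (x n)) ε‖ₑ := by
    intro ε
    refine le_trans (le_of_eq (lintegral_congr_ae ?_)) (lintegral_enorm_le_enorm _)
    have e : signSum S (fun n => bohrTerm X (ENNReal.ofReal p) (primeSeq 0 ^ (n : ℕ)) (x n)) ε =
        ∑ n ∈ S, bohrTerm X (ENNReal.ofReal p) (primeSeq 0 ^ (n : ℕ)) (ε n • x n) := by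
      refine Finset.sum_congr rfl fun n _ => ?_
      rcases Int.units_eq_one_or (ε n) with h | h <;> simp [h]
    rw [e]
    filter_upwards [coeFn_sum_bohrTerm (q := ENNReal.ofReal p) S
      (fun n : ℕ+ => primeSeq 0 ^ (n : ℕ)) fun n => ε n • x n] with w hw
    rw [hw]
    simp only [a, smul_comm (ε _)]
  -- At each fixed w the characters are unimodular multipliers, removed by the contraction principle
  -- at the cost of the factor 2; Fubini and L_1 ≤ L_p finish.
  calc ∫⁻ ε, ‖signSum S x ε‖ₑ ∂signMeasure
      = ∫⁻ _, ∫⁻ ε, ‖signSum S x ε‖ₑ ∂signMeasure ∂polytorusHaar := by simp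
    _ ≤ ∫⁻ w, 2 * ∫⁻ ε, ‖∑ n ∈ S, ε n • torusChar (a n) w • x n‖ₑ ∂signMeasure
          ∂polytorusHaar :=
        lintegral_mono fun w => lintegral_enorm_signSum_le_of_unimodular S
          (fun n => norm_torusChar (a n) w) x
    _ = 2 * ∫⁻ w, ∫⁻ ε, ‖∑ n ∈ S, ε n • torusChar (a n) w • x n‖ₑ ∂signMeasure
          ∂polytorusHaar := lintegral_const_mul' _ _ (by simp)
    _ = 2 * ∫⁻ ε, ∫⁻ w, ‖∑ n ∈ S, ε n • torusChar (a n) w • x n‖ₑ ∂polytorusHaar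
          ∂signMeasure := by
        rw [lintegral_lintegral_swap]
        exact ((stronglyMeasurable_sign_char S a x).enorm.comp measurable_swap).aemeasurable
    _ ≤ _ := mul_le_mul_right (lintegral_mono h1) 2

end PowerSeries

/-! ### From power series to Dirichlet series -/

section Substitution

/-- Finitely many integer sequences are separated by the values of the associated polynomials at a
suitable integer. -/
theorem exists_injOn_weight (S : Finset (ℕ →₀ ℕ)) :
    ∃ B : ℕ, Set.InjOn (fun α : ℕ →₀ ℕ => α.sum fun j a => a * B ^ j) S := by
  classical
  let P : (ℕ →₀ ℕ) → Polynomial ℤ := fun α => α.sum fun j a => Polynomial.monomial j (a : ℤ)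
  have hcoeff : ∀ α j, (P α).coeff j = α j := fun α j => by
    simp only [P, Finsupp.sum, Polynomial.finsetSum_coeff, Polynomial.coeff_monomial]
    rw [Finset.sum_ite_eq']
    split_ifs with h
    · rfl
    · simp [Finsupp.notMem_support_iff.1 h]
  have hP : Function.Injective P := fun α β h => by
    ext j
    have := congrArg (fun Q => Polynomial.coeff Q j) h
    simpa [hcoeff] using this
  have heval : ∀ α (B : ℕ), (P α).eval (B : ℤ) = ((α.sum fun j a => a * B ^ j : ℕ) : ℤ) :=
    fun α B => by simp [P, Finsupp.sum, Polynomial.eval_finsetSum]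
  -- A nonzero polynomial, hence with finitely many roots; any natural number that is not a root
  -- separates the weights.
  let Q : Polynomial ℤ := ∏ i ∈ S.offDiag, (P i.1 - P i.2)
  have hQ : Q ≠ 0 := Finset.prod_ne_zero_iff.2 fun i hi =>
    sub_ne_zero.2 (hP.ne (Finset.mem_offDiag.1 hi).2.2)
  obtain ⟨B, hB⟩ : ∃ B : ℕ, Q.eval (B : ℤ) ≠ 0 := by
    by_contra hcon
    push Not at hcon
    refine hQ (Polynomial.eq_zero_of_infinite_isRoot Q ?_)
    exact (Set.infinite_range_of_injective (Nat.cast_injective (R := ℤ))).mono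
      (by rintro _ ⟨B, rfl⟩; exact hcon B)
  refine ⟨B, fun α hα β hβ h => ?_⟩
  by_contra hne
  refine hB ?_
  rw [Polynomial.eval_prod]
  refine Finset.prod_eq_zero (Finset.mem_offDiag.2 ⟨hα, hβ, hne⟩ : (α, β) ∈ S.offDiag) ?_
  rw [Polynomial.eval_sub, heval, heval, sub_eq_zero]
  exact_mod_cast h

theorem torusChar_bohrExponent_weight (n : ℕ+) (B : ℕ) (z : Circle) :
    torusChar (bohrExponent n) (fun j => z ^ B ^ j) =
      (z : ℂ) ^ ((primeExponent n).sum fun j a => a * B ^ j) := by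
  rw [torusChar, torusMonomial, bohrExponent, Finsupp.prod_mapRange_index (fun _ => zpow_zero _),
    ← Circle.coe_pow, Finsupp.sum, ← Finset.prod_pow_eq_pow_sum, Finsupp.prod]
  congr 1
  refine Finset.prod_congr rfl fun j _ => ?_
  rw [zpow_natCast, ← pow_mul, mul_comm]

variable {X : Type*} [NormedAddCommGroup X] [NormedSpace ℂ X] {p : ℝ}

variable (X p) in
/-- The inequality between Rademacher sums and power series. -/
def CircleBound (C : ℝ≥0) : Prop :=
  ∀ (S : Finset ℕ+) (x : ℕ+ → X), ∫⁻ ε, ‖signSum S x ε‖ₑ ∂signMeasure ≤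
    C * (∫⁻ z : Circle, ‖∑ n ∈ S, (z : ℂ) ^ (n : ℕ) • x n‖ₑ ^ p ∂circleHaar) ^ (1 / p)

theorem CircleBound.of_Icc {C : ℝ≥0} (h : ∀ (N : ℕ+) (x : ℕ+ → X),
    ∫⁻ ε, ‖signSum (Finset.Icc 1 N) x ε‖ₑ ∂signMeasure ≤
      C * (∫⁻ z : Circle, ‖∑ n ∈ Finset.Icc 1 N, (z : ℂ) ^ (n : ℕ) • x n‖ₑ ^ p
        ∂circleHaar) ^ (1 / p)) : CircleBound X p C := by
  intro S x
  obtain ⟨N, hN⟩ := S.bddAbove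
  have hS : S ⊆ Finset.Icc 1 N := fun n hn => Finset.mem_Icc.2 ⟨one_le, hN hn⟩
  have := h N fun n => if n ∈ S then x n else 0
  have e1 : ∀ z : Circle, ∑ n ∈ Finset.Icc 1 N, (z : ℂ) ^ (n : ℕ) • (if n ∈ S then x n else 0) =
      ∑ n ∈ S, (z : ℂ) ^ (n : ℕ) • x n := fun z => by
    rw [← Finset.sum_subset hS fun n _ hn => by simp [hn]]
    exact Finset.sum_congr rfl fun n hn => by simp [hn]
  have e2 : ∀ ε, signSum (Finset.Icc 1 N) (fun n => if n ∈ S then x n else 0) ε =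
      signSum S x ε := fun ε => by
    rw [signSum, ← Finset.sum_subset hS fun n _ hn => by simp [hn]]
    exact Finset.sum_congr rfl fun n hn => by simp [hn]
  simpa only [e1, e2] using this

/-- The law of a Rademacher sum ignores the labels of the signs, so arbitrary distinct exponents are
allowed on the right. -/
theorem CircleBound.reindex {C : ℝ≥0} (h : CircleBound X p C) {S : Finset ℕ+} {φ : ℕ+ → ℕ+}
    (hφ : Set.InjOn φ S) (x : ℕ+ → X) :
    ∫⁻ ε, ‖signSum S x ε‖ₑ ∂signMeasure ≤
      C * (∫⁻ z : Circle, ‖∑ n ∈ S, (z : ℂ) ^ (φ n : ℕ) • x n‖ₑ ^ p ∂circleHaar) ^ (1 / p) := by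
  have := h (S.image φ) fun l => x (Function.invFunOn φ S l)
  have e : ∀ z : Circle, ∑ l ∈ S.image φ, (z : ℂ) ^ (l : ℕ) • x (Function.invFunOn φ S l) =
      ∑ n ∈ S, (z : ℂ) ^ (φ n : ℕ) • x n := fun z =>
    sum_image_invFunOn hφ x fun l v => (z : ℂ) ^ (l : ℕ) • v
  simp only [e] at this
  refine le_trans (le_of_eq ?_) this
  rw [← lintegral_signSum_reindex S _ hφ fun v => ‖v‖ₑ]
  refine lintegral_congr fun ε => ?_
  rw [signSum, sum_image_invFunOn hφ x fun l v => ε l • v]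

/-- The substitution `w_j ↦ z^{B^j} w_j` does not change the norm. -/
theorem lintegral_weight_rotation (hp : 1 ≤ p) [Fact (1 ≤ ENNReal.ofReal p)] (S : Finset ℕ+)
    (x : ℕ+ → X) (φ : ℕ+ → ℕ+) (B : ℕ)
    (hφ : ∀ n, (φ n : ℕ) = ((primeExponent n).sum fun j a => a * B ^ j) + 1) :
    ∫⁻ w, ∫⁻ z : Circle, ‖∑ n ∈ S, (z : ℂ) ^ (φ n : ℕ) • torusChar (bohrExponent n) w • x n‖ₑ ^ p
      ∂circleHaar ∂polytorusHaar = ‖∑ n ∈ S, bohrTerm X (ENNReal.ofReal p) n (x n)‖ₑ ^ p := by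
  have hcoe : Continuous fun z : Circle => (z : ℂ) := continuous_subtype_val
  have hchar := fun α => continuous_torusChar α
  have hcont : Continuous fun i : (ℕ → Circle) × Circle =>
      ∑ n ∈ S, (i.2 : ℂ) ^ (φ n : ℕ) • torusChar (bohrExponent n) i.1 • x n := by fun_prop
  rw [lintegral_lintegral_swap (hcont.enorm.measurable.pow_const p).aemeasurable]
  have hz : ∀ z : Circle, ∫⁻ w, ‖∑ n ∈ S, (z : ℂ) ^ (φ n : ℕ) •
      torusChar (bohrExponent n) w • x n‖ₑ ^ p ∂polytorusHaar =
        ‖∑ n ∈ S, bohrTerm X (ENNReal.ofReal p) n (x n)‖ₑ ^ p := fun z => by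
    let u : ℕ → Circle := fun j => z ^ B ^ j
    rw [enorm_sum_bohrTerm_rpow hp S (fun n => n) x]
    have hcw : Continuous fun w => ∑ n ∈ S, torusChar (bohrExponent n) w • x n := by fun_prop
    rw [← (measurePreserving_rotation u).lintegral_comp
      (f := fun w => ‖∑ n ∈ S, torusChar (bohrExponent n) w • x n‖ₑ ^ p)
      (hcw.enorm.measurable.pow_const p)]
    refine lintegral_congr fun w => ?_
    -- The shift by one in φ contributes only the common unimodular factor z; the remaining powers
    -- of z come from rotating w by u.
    have e : ∑ n ∈ S, (z : ℂ) ^ (φ n : ℕ) • torusChar (bohrExponent n) w • x n =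
        (z : ℂ) • ∑ n ∈ S, torusChar (bohrExponent n) (u * w) • x n := by
      rw [Finset.smul_sum]
      refine Finset.sum_congr rfl fun n _ => ?_
      rw [torusChar_mul, torusChar_bohrExponent_weight, hφ, pow_succ', smul_smul, smul_smul,
        mul_assoc]
    rw [e, enorm_smul, ← ofReal_norm (z : ℂ), Circle.norm_coe, ENNReal.ofReal_one, one_mul]
  simp [hz]

/-- A uniform bound for power series implies one for Dirichlet series. -/
theorem CircleBound.exists_radBound (hp : 1 ≤ p) [Fact (1 ≤ ENNReal.ofReal p)] {C : ℝ≥0}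
    (h : CircleBound X p C) : ∃ C', RadBound X (ENNReal.ofReal p) C' := by
  classical
  have hp0 : 0 < p := by linarith
  obtain ⟨K, hK⟩ := exists_eLpNorm_signSum_le X p
  refine ⟨K * C, fun S x => ?_⟩
  obtain ⟨B, hB⟩ := exists_injOn_weight (S.image primeExponent)
  -- The successor is needed because the weight of n = 1 is 0, while the exponents in the circle
  -- inequality start at 1.
  let φ : ℕ+ → ℕ+ := fun n => Nat.succPNat ((primeExponent n).sum fun j a => a * B ^ j)
  have hφ : Set.InjOn φ S := fun m hm n hn e =>
    primeExponent_injective (hB (Finset.mem_coe.2 (Finset.mem_image_of_mem _ hm))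
      (Finset.mem_coe.2 (Finset.mem_image_of_mem _ hn)) (Nat.succPNat_injective e))
  set Q := ‖∑ n ∈ S, bohrTerm X (ENNReal.ofReal p) n (x n)‖ₑ with hQ
  let I : (ℕ → Circle) → ℝ≥0∞ := fun w => ∫⁻ z : Circle,
    ‖∑ n ∈ S, (z : ℂ) ^ (φ n : ℕ) • torusChar (bohrExponent n) w • x n‖ₑ ^ p ∂circleHaar
  have hI : ∫⁻ w, I w ∂polytorusHaar = Q ^ p :=
    lintegral_weight_rotation hp S x φ B fun n => rfl
  -- Kahane's inequality in X turns the first moment given by the circle inequality into a p-th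
  -- moment, which can be integrated in w and exchanged with the expectation.
  have hpt : ∀ w, ∫⁻ ε, ‖∑ n ∈ S, ε n • torusChar (bohrExponent n) w • x n‖ₑ ^ p ∂signMeasure ≤
      (K * C : ℝ≥0∞) ^ p * I w := fun w => by
    have h1 := hK S fun n => torusChar (bohrExponent n) w • x n
    have h2 := h.reindex hφ fun n => torusChar (bohrExponent n) w • x n
    have h3 := ENNReal.rpow_le_rpow (h1.trans (mul_le_mul_right h2 K)) hp0.le
    rw [eLpNorm_eq_lintegral_rpow_enorm_toReal (ENNReal.ofReal_pos.2 hp0).ne' ENNReal.ofReal_ne_top,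
      ENNReal.toReal_ofReal hp0.le, ← ENNReal.rpow_mul, one_div_mul_cancel hp0.ne',
      ENNReal.rpow_one, ← mul_assoc, ENNReal.mul_rpow_of_nonneg _ _ hp0.le, ← ENNReal.rpow_mul,
      one_div_mul_cancel hp0.ne', ENNReal.rpow_one] at h3
    exact h3
  let y : ℕ+ → Lp X (ENNReal.ofReal p) polytorusHaar := fun n => bohrTerm X _ n (x n)
  have hy : ∀ ε, ‖signSum S y ε‖ₑ ^ p =
      ∫⁻ w, ‖∑ n ∈ S, ε n • torusChar (bohrExponent n) w • x n‖ₑ ^ p ∂polytorusHaar := fun ε => by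
    rw [← sum_bohrTerm_smul, enorm_sum_bohrTerm_rpow hp S (fun n => n)]
    simp only [smul_comm (ε _)]
  have hmom : ∫⁻ ε, ‖signSum S y ε‖ₑ ^ p ∂signMeasure ≤ ((K * C : ℝ≥0∞) * Q) ^ p := by
    simp only [hy]
    rw [lintegral_lintegral_swap
      ((stronglyMeasurable_sign_char S bohrExponent x).enorm.pow_const p).aemeasurable]
    refine (lintegral_mono hpt).trans (le_of_eq ?_)
    rw [lintegral_const_mul' _ _ (by finiteness), hI, ENNReal.mul_rpow_of_nonneg _ Q hp0.le]
  have hJ : ∫⁻ ε, ‖signSum S y ε‖ₑ ∂signMeasure ≤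
      (∫⁻ ε, ‖signSum S y ε‖ₑ ^ p ∂signMeasure) ^ (1 / p) := by
    have := eLpNorm_le_eLpNorm_of_exponent_le (μ := signMeasure)
      (Fact.out : 1 ≤ ENNReal.ofReal p)
      (stronglyMeasurable_comp_signSum S y id).aestronglyMeasurable
    rwa [eLpNorm_one_eq_lintegral_enorm,
      eLpNorm_eq_lintegral_rpow_enorm_toReal (ENNReal.ofReal_pos.2 hp0).ne' ENNReal.ofReal_ne_top,
      ENNReal.toReal_ofReal hp0.le] at this
  refine hJ.trans ((ENNReal.rpow_le_rpow hmom (by positivity)).trans (le_of_eq ?_))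
  rw [← ENNReal.rpow_mul, mul_one_div_cancel hp0.ne', ENNReal.rpow_one, ENNReal.coe_mul]

end Substitution

end DirichletRUC

/-! ### Assembly of the equivalences -/

open DirichletRUC

theorem mainTheorem4 {X : Type*} [NormedAddCommGroup X] [NormedSpace ℂ X] [CompleteSpace X]
    (p : ℝ) (hp : 2 ≤ p) :
    List.TFAE [
      ∀ x : ℕ+ → X,
        DirichletRUC.IsRUC (DirichletRUC.dirichletHardyNorm p)
          (fun n => DirichletRUC.dirichletTerm n (x n)),
      ∃ C : ℝ≥0, 1 ≤ C ∧ ∀ (N : ℕ+) (x : ℕ+ → X),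
        DirichletRUC.dirichletHardyRadNorm p (DirichletRUC.dirichletPolynomial N x) ≤
          C * DirichletRUC.dirichletHardyNorm p (DirichletRUC.dirichletPolynomial N x),
      (DirichletRUC.dirichletHardy p : Set (ℕ+ → X)) ⊆ DirichletRUC.dirichletHardyRad p,
      ∃ C : ℝ≥0, 1 ≤ C ∧ ∀ (N : ℕ+) (x : ℕ+ → X),
        ∫⁻ ε, ‖∑ n ∈ Finset.Icc 1 N, ε n • x n‖ₑ ∂DirichletRUC.signMeasure ≤
          C * (∫⁻ z : Circle, ‖∑ n ∈ Finset.Icc 1 N, (z : ℂ) ^ (n : ℕ) • x n‖ₑ ^ p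
            ∂DirichletRUC.circleHaar) ^ (1 / p)] := by
  have hp1 : 1 ≤ p := by linarith
  have : Fact (1 ≤ ENNReal.ofReal p) := ⟨ENNReal.one_le_ofReal.2 hp1⟩
  have hq : ENNReal.ofReal p ≠ ∞ := ENNReal.ofReal_ne_top
  -- Everything is compared with the uniform bound for all finite sets of indices.
  let B := ∃ C, RadBound X (ENNReal.ofReal p) C
  have hterm : ∀ (c : ℂ) (n : ℕ+) (v : X), c • dirichletTerm n v = dirichletTerm n (c • v) :=
    fun c n v => by
      ext m
      by_cases h : m = n <;> simp [dirichletTerm, h]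
  have hterm' : ∀ (e : ℤˣ) (n : ℕ+) (v : X), e • dirichletTerm n v = dirichletTerm n (e • v) :=
    fun e n v => by
      ext m
      by_cases h : m = n <;> simp [dirichletTerm, h]
  have hruc : ∀ (S : Finset ℕ+) (y : ℕ+ → X),
      ∫⁻ ε, dirichletHardyNorm p (∑ n ∈ S, ε n • dirichletTerm n (y n)) ∂signMeasure =
        ∫⁻ ε, ‖signSum S (fun n => bohrTerm X (ENNReal.ofReal p) n (y n)) ε‖ₑ ∂signMeasure := by
    intro S y
    refine lintegral_congr fun ε => ?_
    have e : ∑ n ∈ S, ε n • dirichletTerm n (y n) = ∑ n ∈ S, dirichletTerm n (ε n • y n) :=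
      Finset.sum_congr rfl fun n _ => hterm' _ _ _
    rw [e, dirichletHardyNorm_sum, sum_bohrTerm_smul]
  have hBb : B → ∃ C : ℝ≥0, 1 ≤ C ∧ ∀ (N : ℕ+) (x : ℕ+ → X),
      dirichletHardyRadNorm p (dirichletPolynomial N x) ≤
        C * dirichletHardyNorm p (dirichletPolynomial N x) := by
    rintro ⟨C, hC⟩
    refine ⟨max 1 C, le_max_left _ _, fun N x => ?_⟩
    rw [dirichletPolynomial, dirichletHardyRadNorm_sum, dirichletHardyNorm_sum]
    exact (hC _ x).trans (by gcongr; exact le_max_right _ _)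
  have hbB : (∃ C : ℝ≥0, 1 ≤ C ∧ ∀ (N : ℕ+) (x : ℕ+ → X),
      dirichletHardyRadNorm p (dirichletPolynomial N x) ≤
        C * dirichletHardyNorm p (dirichletPolynomial N x)) → B := by
    rintro ⟨C, -, hC⟩
    refine ⟨C, RadBound.of_Icc fun N x => ?_⟩
    have := hC N x
    rwa [dirichletPolynomial, dirichletHardyRadNorm_sum, dirichletHardyNorm_sum] at this
  tfae_have 2 → 1 := by
    intro h x
    obtain ⟨C, hC⟩ := hbB h
    refine ⟨C, fun m a => ?_⟩
    simp only [hterm]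
    rw [hruc, dirichletHardyNorm_sum]
    exact hC _ _
  tfae_have 1 → 2 := by
    intro h
    refine hBb (exists_radBound_of_forall_sequence fun x => ?_)
    obtain ⟨C, hC⟩ := h x
    refine ⟨C, fun S => ?_⟩
    obtain ⟨N, hN⟩ := S.bddAbove
    have hS : S ⊆ Finset.Icc 1 N := fun n hn => Finset.mem_Icc.2 ⟨one_le, hN hn⟩
    -- The free scalars in the RUC inequality select an arbitrary finite set of indices.
    have := hC N fun n => if n ∈ S then 1 else 0
    simp only [hterm] at this
    rw [hruc, dirichletHardyNorm_sum] at this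
    have e1 : ∑ n ∈ Finset.Icc 1 N, bohrTerm X (ENNReal.ofReal p) n
        ((if n ∈ S then (1 : ℂ) else 0) • x n) = ∑ n ∈ S, bohrTerm X (ENNReal.ofReal p) n (x n) := by
      rw [← Finset.sum_subset hS fun n _ hn => by simp [hn]]
      exact Finset.sum_congr rfl fun n hn => by simp [hn]
    have e2 : ∀ ε, signSum (Finset.Icc 1 N) (fun n => bohrTerm X (ENNReal.ofReal p) n
        ((if n ∈ S then (1 : ℂ) else 0) • x n)) ε =
          signSum S (fun n => bohrTerm X (ENNReal.ofReal p) n (x n)) ε := fun ε => by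
      rw [signSum, ← Finset.sum_subset hS fun n _ hn => by simp [hn]]
      exact Finset.sum_congr rfl fun n hn => by simp [hn]
    simpa only [e1, e2] using this
  tfae_have 2 → 3 := by
    intro h D hD
    obtain ⟨C, hC⟩ := hbB h
    obtain ⟨F, hF⟩ := mem_dirichletHardy_iff.1 hD
    filter_upwards [hC.ae_exists_isHardyLift hq hF] with ε hε
    exact mem_dirichletHardy_iff.2 hε
  tfae_have 3 → 2 := by
    intro h
    refine hBb (exists_radBound_of_subset hq fun D F hF => ?_)
    have hD : D ∈ dirichletHardyRad p := h (mem_dirichletHardy_iff.2 ⟨F, hF⟩)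
    have hD' : ∀ᵐ ε ∂signMeasure, (fun n => ε n • D n) ∈ dirichletHardy p := hD
    filter_upwards [hD'] with ε hε
    exact mem_dirichletHardy_iff.1 hε
  tfae_have 2 → 4 := by
    intro h
    obtain ⟨C, hC⟩ := hbB h
    -- The 2 is from the contraction principle; the maximum only ensures a constant of at least 1.
    refine ⟨max 1 (2 * C), le_max_left _ _, fun N x => ?_⟩
    refine (hC.circle hp1 (Finset.Icc 1 N) x).trans (mul_le_mul_left ?_ _)
    exact_mod_cast le_max_right 1 (2 * C)
  tfae_have 4 → 2 := by
    rintro ⟨C, -, hC⟩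
    exact hBb ((CircleBound.of_Icc hC).exists_radBound hp1)
  tfae_finish
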